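/- **Setting.** Let $m\ge 1$, let $G=\mathbb Z_m$ act on $\{1,\dots,N\}$ through a homomorphism $\sigma\colon\mathbb Z_m\to\Sigma_N$ (for instance by cyclically permuting $m$ blocks of equal size), and hence on the poset $\underline 2^N=\{0,1\}^N$, regarded as a category with one arrow $u\to v$ whenever $u\ge v$; put $|u|=\sum_i u_i$. Let $C_\sigma(N)$ be the free topological category on $\underline 2^N$ with the induced $\mathbb Z_m$-action: the points of $C_\sigma(N)(u,v)$ are chains strictly between $v$ and $u$ whose members carry parameters in $[0,1]$, members with parameter $1$ being deleted, and composition concatenates chains, giving the middle vertex the parameter $0$. These spaces are given the smooth structure of permutohedra, with multifacets $\partial_i C_\sigma(N)(u,v)$ consisting of the composites through vertices $w$ with $|w|=|v|+i$. A homotopy coherent diagram $\underline 2^N\to\mathrm{Top}_*$ is a continuous functor from $C_\sigma(N)$ to pointed spaces. Let $(\mathcal C,\ f\colon\Sigma^{U}\mathcal C\to C_\sigma(N))$ be a $\mathbb Z_m$-equivariant cubical flow category with finitely many objects: a $\mathbb Z_m$-equivariant flow category $\mathcal C$ (a topological category with discrete objects and a grading $\mathrm{gr}$, whose morphism spaces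 between distinct objects, the moduli spaces $\mathcal M(x,y)$, are compact $(k-1)$-dimensional $\langle k-1\rangle$-manifolds with corners, $k=\mathrm{gr}(x)-\mathrm{gr}(y)$, such that composition gives diffeomorphisms $\coprod_{\mathrm{gr}(z)=\mathrm{gr}(y)+i}\mathcal M(z,y)\times\mathcal M(x,z)\cong\partial_i\mathcal M(x,y)$; with functors $\mathcal G_g$, $\mathcal G_g\mathcal G_h=\mathcal G_{gh}$, that preserve $\mathrm{gr}$ and are diffeomorphisms of moduli spaces; and with equivariant gradings $\mathrm{gr}_G(x)\in RO(G_x)$ of dimension $\mathrm{gr}(x)$, natural under conjugation, such that $\mathcal M(x,y)$ has equivariant dimension $\mathrm{gr}_G(x)-\mathrm{gr}_G(y)-\mathbb R$), with a $\mathbb Z_m$-equivariant functor $f$ that is a covering on moduli spaces and satisfies $\mathrm{gr}_G(x)+U|_{G_x}=\mathbb R^{\{i:\,f(x)_i=1\}}$ in $RO(G_x)$, for some virtual representation $U$ of $\mathbb Z_m$. *The Burnside functor with external action associated to $\mathcal C$.* Put $F(u)=f^{-1}(u)$; for $u>v$ let $F(u,v)$ be the set of path components of $\coprod_{f(x)=u,\,f(y)=v}\mathcal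 M(x,y)$, a correspondence from $F(u)$ to $F(v)$ through the source and the target; for $u>v>w$ let $F(v,w)\times_{F(v)}F(u,v)\to F(u,w)$ be induced by composition in $\mathcal C$. The functors $\mathcal G_g\colon\mathcal C\to\mathcal C$ ($g\in\mathbb Z_m$) induce bijections $\phi_{g,u}\colon F(u)\to F(gu)$ and $\phi_{g,u,v}\colon F(u,v)\to F(gu,gv)$. Let $\psi$ consist of the correspondences $\psi_{g,u}=[F(u)\xleftarrow{\mathrm{id}}F(u)\xrightarrow{\phi_{g,u}}F(gu)]$, and of the maps of correspondences $\psi_{gh,u}\to\psi_{g,hu}\circ\psi_{h,u}$, $x\mapsto(\phi_{h,u}(x),x)$, and $\psi_{g,v}\circ F(u,v)\to F(gu,gv)\circ\psi_{g,u}$, $(t(a),a)\mapsto(\phi_{g,u,v}(a),s(a))$. *Framed embeddings.* Let $V$ be a finite-dimensional orthogonal representation of $\mathbb Z_m$, let $e=(e_0,\dots,e_{N-1})\in\mathbb N^N$, and let $R,\varepsilon>0$. Write $B_r(V)$ for the closed ball of radius $r$ and $E(V)_{u,v}=\prod_{i=|v|}^{|u|-1}B_R(V)^{e_i}\times C_\sigma(N)(u,v)$.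 Let $\iota_{x,y}=(j_{x,y},f)\colon\mathcal M(x,y)\to E(V)_{f(x),f(y)}$ be an equivariant cubical neat embedding of $\mathcal C$: the maps $\iota_{x,y}$ over fixed $u=f(x)$, $v=f(y)$ form together a neat embedding into $E(V)_{u,v}$ (a smooth embedding, under which the multifacets are the preimages of the $\partial_i$, and whose strata meet those of $E(V)_{u,v}$ perpendicularly for some Riemannian metric), and they are compatible with composition and with the action of $\mathbb Z_m$. Let it be framed by translation: the maps $$\bar\iota_{x,y}\colon\prod_{i=|f(y)|}^{|f(x)|-1}B_\varepsilon(V)^{e_i}\times\mathcal M(x,y)\to E(V)_{f(x),f(y)},\qquad (a,p)\mapsto(a+j_{x,y}(p),\,f(p)),$$ are well defined and, for all $u>v$, those with $f(x)=u$ and $f(y)=v$ form together an embedding of the disjoint union of their domains. *The diagram.* Put $W=\bigoplus_{i=0}^{N-1}V^{e_i}$. For $x\in F(u)$ let $B_x=\prod_{i<|u|}B_R(V)^{e_i}\times\prod_{i\ge|u|}B_\varepsilon(V)^{e_i}\subset W$. A *star* in $W$ is a set $\{p+\alpha\theta:\theta\in S(W),\ 0\le\alpha\le r(\theta)\}\cup\{p\}$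 with centre $p\in W$ and continuous radial function $r\colon S(W)\to(0,\infty)$; $B_x$ is a star with centre $0$. For $t\in C_\sigma(N)(u,v)$, $u>v$, and $c\in F(u,v)$, a path component of $\mathcal M(x,y)$, let $\bar\iota_{u,v}(t)_c=j_{x,y}(p)+B_y$, where $p$ is the point of $c$ over $t$. Put $\tilde F_V(u)=\bigvee_{x\in F(u)}B_x/\partial B_x$ (for $W=0$, $B_x/\partial B_x$ is $B_x$ with a disjoint base point), and for $t\in C_\sigma(N)(u,v)$ let $\tilde F_V(u,v)(t)$ be the star map $\Phi(\bar\iota_{u,v}(t),F(u,v))$: it collapses the complement of the interiors of the stars $\bar\iota_{u,v}(t)_c$, $s(c)=x$, in $B_x$ to the base point, and identifies $\bar\iota_{u,v}(t)_c$ radially with $B_{t(c)}$. **Proposition.** $F$ is a Burnside functor $\underline 2^N\to\mathscr B$ and $\psi$ is an external action of $\mathbb Z_m$ on it, compatible with the action on $\underline 2^N$. The maps $\tilde F_V(u,v)$, $u>v$, together with identities, form a homotopy coherent diagram $\tilde F_V\colon\underline 2^N\to\mathrm{Top}_*$, which is a $\mathbb Z_m$-coherent spatial refinement of $F$ modeled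 on $W$. That is: the stars $B_x$ are centred at $0$ and $\mathbb Z_m$-invariant; for $u>v$, $t\mapsto\bar\iota_{u,v}(t)$ is a continuous map from $C_\sigma(N)(u,v)$ to the space of families of pairwise disjoint stars labelled by $F(u,v)$, the star labelled $c$ being contained in $B_{s(c)}$; one has $\tilde F_V(u,v)(t)=\Phi(\bar\iota_{u,v}(t),F(u,v))$; and for all $g\in\mathbb Z_m$, $u\ge v$, $t\in C_\sigma(N)(u,v)$ and $p\in\tilde F_V(u)$, $$g\cdot\bigl(\tilde F_V(u,v)(t)(p)\bigr)=\tilde F_V(gu,gv)(g\cdot t)(g\cdot p),$$ where $g\in\mathbb Z_m$ acts by $(x,p)\mapsto(\phi_{g,u}(x),g\cdot p)$ for $p\in B_x/\partial B_x$, $x\in F(u)$. -/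

import Mathlib

open scoped Manifold ContDiff

universe u v w

noncomputable section

/-! ### The free topological category of a poset, and homotopy coherent diagrams

A poset is regarded as a category with exactly one arrow `u ⟶ v` whenever `v ≤ u`. -/

/-- The space of morphisms `u ⟶ v` of the free topological category on a (finite) poset `P`.
A point of it is given by a chain in the open interval `(v, u)` together with a parameter in
`[0, 1]` for each member of the chain, a member with parameter `1` being identified with an absent
one.  Such a class is the same thing as a function `t : P → [0, 1]` that is `1` off `(v, u)` and
for which `{w | t w < 1}` is a chain; for `u = v` only the identity (`t = 1`) remains. -/
def FreeHom {P : Type u} [PartialOrder P] (u v : P) : Type u :=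
  {t : P → unitInterval // v ≤ u ∧ (∀ w, ¬ (v < w ∧ w < u) → t w = 1) ∧
    IsChain (· ≤ ·) {w | t w < 1}}

namespace FreeHom

variable {P : Type u} [PartialOrder P]

instance (u v : P) : TopologicalSpace (FreeHom u v) := instTopologicalSpaceSubtype

theorem le {u v : P} (t : FreeHom u v) : v ≤ u := t.2.1

theorem lt_of_lt_one {u v : P} (t : FreeHom u v) {x : P} (hx : t.1 x < 1) : v < x ∧ x < u := by
  by_contra h
  exact absurd (t.2.2.1 x h) hx.ne

/-- The identity morphism. -/
def id (u : P) : FreeHom u u :=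
  ⟨fun _ => 1, le_rfl, fun _ _ => rfl, by intro x hx; simp at hx⟩

open Classical in
/-- The composite of `t : u ⟶ v` and `s : v ⟶ w`: the two chains are concatenated along `v`,
which receives the parameter `0` (nothing is inserted when one of the two is an identity). -/
def comp {u v w : P} (s : FreeHom v w) (t : FreeHom u v) : FreeHom u w :=
  ⟨fun x => if x = v ∧ w < v ∧ v < u then 0 else min (s.1 x) (t.1 x),
    s.le.trans t.le, by
      intro x hx
      have h1 : ¬ (x = v ∧ w < v ∧ v < u) := by rintro ⟨rfl, h⟩; exact hx h
      have h2 : s.1 x = 1 := s.2.2.1 x (fun h => hx ⟨h.1, h.2.trans_le t.le⟩)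
      have h3 : t.1 x = 1 := t.2.2.1 x (fun h => hx ⟨s.le.trans_lt h.1, h.2⟩)
      simp only [if_neg h1, h2, h3, min_self], by
      have key : ∀ x : P, (if x = v ∧ w < v ∧ v < u then (0 : unitInterval) else min (s.1 x) (t.1 x)) < 1 →
          x = v ∨ s.1 x < 1 ∨ t.1 x < 1 := by
        intro x hx
        split_ifs at hx with h
        · exact Or.inl h.1
        · exact Or.inr (min_lt_iff.mp hx)
      intro x hx y hy hxy
      rcases key x hx with rfl | h1 | h1 <;> rcases key y hy with rfl | h2 | h2
      · exact absurd rfl hxy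
      · exact Or.inr (s.lt_of_lt_one h2).2.le
      · exact Or.inl (t.lt_of_lt_one h2).1.le
      · exact Or.inl (s.lt_of_lt_one h1).2.le
      · exact s.2.2.2 h1 h2 hxy
      · exact Or.inl ((s.lt_of_lt_one h1).2.trans (t.lt_of_lt_one h2).1).le
      · exact Or.inr (t.lt_of_lt_one h1).1.le
      · exact Or.inr ((s.lt_of_lt_one h2).2.trans (t.lt_of_lt_one h1).1).le
      · exact t.2.2.2 h1 h2 hxy⟩

/-- The map of morphism spaces induced by an automorphism of the poset. -/
def map (φ : P ≃o P) {u v : P} (t : FreeHom u v) : FreeHom (φ u) (φ v) :=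
  ⟨fun x => t.1 (φ.symm x), φ.monotone t.le, by
      intro x hx
      refine t.2.2.1 _ (fun h => hx ⟨?_, ?_⟩)
      · have := φ.lt_iff_lt.mpr h.1
        rwa [φ.apply_symm_apply] at this
      · have := φ.lt_iff_lt.mpr h.2
        rwa [φ.apply_symm_apply] at this, by
      intro x hx y hy hxy
      have := t.2.2.2 hx hy (fun h => hxy (φ.symm.injective h))
      simpa using this⟩

end FreeHom

/-- A homotopy coherent diagram of shape `P` with given pointed spaces `X u` at the vertices: a
topological functor from the free topological category on `P` to pointed spaces. -/
structure HCDiagram {P : Type u} [PartialOrder P] (X : P → Type w)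
    [∀ u, TopologicalSpace (X u)] (pt : ∀ u, X u) where
  map : ∀ {u v : P}, FreeHom u v → X u → X v
  continuous_map : ∀ u v : P, Continuous (fun z : FreeHom u v × X u => map z.1 z.2)
  map_pt : ∀ {u v : P} (t : FreeHom u v), map t (pt u) = pt v
  map_id : ∀ (u : P) (p : X u), map (FreeHom.id u) p = p
  map_comp : ∀ {u v w : P} (s : FreeHom v w) (t : FreeHom u v) (p : X u),
    map (s.comp t) p = map s (map t p)

/-! ### The Burnside 2-category -/

/-- A correspondence from `X` to `Y`. -/
structure Correspondence (X Y : Type u) where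
  carrier : Type w
  s : carrier → X
  t : carrier → Y

/-- The composite correspondence `B ∘ A = B ×_Y A`. -/
def Correspondence.comp {X Y Z : Type u} (B : Correspondence.{u, w} Y Z)
    (A : Correspondence.{u, v} X Y) : Correspondence.{u, max v w} X Z where
  carrier := {z : B.carrier × A.carrier // A.t z.2 = B.s z.1}
  s z := A.s z.1.2
  t z := B.t z.1.1

/-- The data of a strictly unitary functor from a poset to the Burnside 2-category: sets `F(v)`,
correspondences `F(u, v)` and maps `F(u, v, w) : F(v, w) ×_{F(v)} F(u, v) → F(u, w)`, for
`u > v > w` (identity arrows go to identity correspondences and carry no data). -/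
structure BurnsideData (P : Type v) [PartialOrder P] where
  obj : P → Type u
  corr : ∀ u v : P, Correspondence.{u, w} (obj u) (obj v)
  comp : ∀ {u v w : P}, w < v → v < u → ((corr v w).comp (corr u v)).carrier → (corr u w).carrier

/-- The laws of a strictly unitary functor from a poset to the Burnside 2-category: the sets are
finite, the maps `F(u, v, w)` are isomorphisms of correspondences, and they are associative. -/
structure BurnsideData.IsFunctor {P : Type v} [PartialOrder P] (F : BurnsideData.{u, v, w} P) :
    Prop where
  finite_obj : ∀ v, Finite (F.obj v)
  finite_corr : ∀ u v, v < u → Finite (F.corr u v).carrier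
  bijective : ∀ {u v w : P} (h₁ : w < v) (h₂ : v < u), Function.Bijective (F.comp h₁ h₂)
  source : ∀ {u v w : P} (h₁ : w < v) (h₂ : v < u) z,
    (F.corr u w).s (F.comp h₁ h₂ z) = ((F.corr v w).comp (F.corr u v)).s z
  target : ∀ {u v w : P} (h₁ : w < v) (h₂ : v < u) z,
    (F.corr u w).t (F.comp h₁ h₂ z) = ((F.corr v w).comp (F.corr u v)).t z
  assoc : ∀ {u v w x : P} (h₁ : x < w) (h₂ : w < v) (h₃ : v < u)
    (c : (F.corr w x).carrier) (b : (F.corr v w).carrier) (a : (F.corr u v).carrier)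
    (e₁ : (F.corr v w).t b = (F.corr w x).s c) (e₂ : (F.corr u v).t a = (F.corr v w).s b)
    (e₃ : (F.corr u v).t a = (F.corr v x).s (F.comp h₁ h₂ ⟨(c, b), e₁⟩))
    (e₄ : (F.corr u w).t (F.comp h₂ h₃ ⟨(b, a), e₂⟩) = (F.corr w x).s c),
    F.comp (h₁.trans h₂) h₃ ⟨(F.comp h₁ h₂ ⟨(c, b), e₁⟩, a), e₃⟩ =
      F.comp h₁ (h₂.trans h₃) ⟨(c, F.comp h₂ h₃ ⟨(b, a), e₂⟩), e₄⟩

/-- An invertible 1-morphism of the Burnside 2-category. -/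
structure InvCorrespondence (X Y : Type u) extends Correspondence.{u, w} X Y where
  s_bijective : Function.Bijective s
  t_bijective : Function.Bijective t

/-- The bijection `t ∘ s⁻¹` of an invertible correspondence. -/
def InvCorrespondence.toFun {X Y : Type u} (A : InvCorrespondence.{u, w} X Y) (x : X) : Y :=
  A.t ((Equiv.ofBijective A.s A.s_bijective).symm x)

/-- The data of an external action on `F`, compatible with an action `γ` on the poset:
1-isomorphisms `ψ_{g, v} : F(v) → F(gv)`, and the maps underlying the 2-morphisms
`ψ_{g, h, v} : ψ_{gh, v} → ψ_{g, hv} ∘ ψ_{h, v}` and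
`ψ_{g, u, v} : ψ_{g, v} ∘ F(u, v) → F(gu, gv) ∘ ψ_{g, u}`. -/
structure ExternalActionData {G : Type*} [Group G] {P : Type v} [PartialOrder P]
    (γ : G →* (P ≃o P)) (F : BurnsideData.{u, v, w} P) where
  psi : ∀ (g : G) (v : P), InvCorrespondence.{u, u} (F.obj v) (F.obj (γ g v))
  two : ∀ (g h : G) (v : P), (psi (g * h) v).carrier →
    ((psi g (γ h v)).toCorrespondence.comp (psi h v).toCorrespondence).carrier
  sq : ∀ (g : G) (u v : P), ((psi g v).toCorrespondence.comp (F.corr u v)).carrier →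
    ((F.corr (γ g u) (γ g v)).comp (psi g u).toCorrespondence).carrier

/-- The laws of an external action on a Burnside functor.  As `γ (g * h) v` and `γ g (γ h v)` are
equal, but not syntactically so, elements over them are compared in a disjoint union over `P`. -/
structure ExternalActionData.IsExternalAction {G : Type*} [Group G] {P : Type v} [PartialOrder P]
    {γ : G →* (P ≃o P)} {F : BurnsideData.{u, v, w} P} (Ψ : ExternalActionData γ F) : Prop where
  two_bijective : ∀ g h v, Function.Bijective (Ψ.two g h v)
  two_source : ∀ g h v c,
    ((Ψ.psi g (γ h v)).toCorrespondence.comp (Ψ.psi h v).toCorrespondence).s (Ψ.two g h v c) =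
      (Ψ.psi (g * h) v).s c
  two_target : ∀ g h v c,
    (⟨_, ((Ψ.psi g (γ h v)).toCorrespondence.comp (Ψ.psi h v).toCorrespondence).t
        (Ψ.two g h v c)⟩ : Σ v, F.obj v) =
      ⟨_, (Ψ.psi (g * h) v).t c⟩
  sq_bijective : ∀ g u v, v < u → Function.Bijective (Ψ.sq g u v)
  sq_source : ∀ g u v, v < u → ∀ z,
    ((F.corr (γ g u) (γ g v)).comp (Ψ.psi g u).toCorrespondence).s (Ψ.sq g u v z) =
      ((Ψ.psi g v).toCorrespondence.comp (F.corr u v)).s z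
  sq_target : ∀ g u v, v < u → ∀ z,
    ((F.corr (γ g u) (γ g v)).comp (Ψ.psi g u).toCorrespondence).t (Ψ.sq g u v z) =
      ((Ψ.psi g v).toCorrespondence.comp (F.corr u v)).t z
  /-- Compatibility with the group law: `ψ_{gh, u, v}` is the composite of `ψ_{g, h, v}`,
  `ψ_{h, u, v}`, `ψ_{g, hu, hv}` and the inverse of `ψ_{g, h, u}`. -/
  group_law : ∀ (g h : G) (u v : P), v < u →
    ∀ (c : (Ψ.psi (g * h) v).carrier) (a : (F.corr u v).carrier)
    (e₁ : (F.corr u v).t a = (Ψ.psi (g * h) v).s c)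
    (e₂ : (F.corr u v).t a = (Ψ.psi h v).s (Ψ.two g h v c).1.2)
    (e₃ : (F.corr (γ h u) (γ h v)).t (Ψ.sq h u v ⟨((Ψ.two g h v c).1.2, a), e₂⟩).1.1 =
      (Ψ.psi g (γ h v)).s (Ψ.two g h v c).1.1),
    (⟨_, _, (Ψ.sq (g * h) u v ⟨(c, a), e₁⟩).1.1⟩ : Σ u v : P, (F.corr u v).carrier) =
        ⟨_, _, (Ψ.sq g (γ h u) (γ h v) ⟨((Ψ.two g h v c).1.1,
          (Ψ.sq h u v ⟨((Ψ.two g h v c).1.2, a), e₂⟩).1.1), e₃⟩).1.1⟩ ∧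
      (Ψ.two g h u (Ψ.sq (g * h) u v ⟨(c, a), e₁⟩).1.2).1 =
        ((Ψ.sq g (γ h u) (γ h v) ⟨((Ψ.two g h v c).1.1,
          (Ψ.sq h u v ⟨((Ψ.two g h v c).1.2, a), e₂⟩).1.1), e₃⟩).1.2,
         (Ψ.sq h u v ⟨((Ψ.two g h v c).1.2, a), e₂⟩).1.2)
  /-- Compatibility with composition in `F`. -/
  composition_law : ∀ (g : G) {u v w : P} (h₁ : w < v) (h₂ : v < u)
    (c : (Ψ.psi g w).carrier) (b : (F.corr v w).carrier) (a : (F.corr u v).carrier)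
    (e₁ : (F.corr v w).t b = (Ψ.psi g w).s c) (e₂ : (F.corr u v).t a = (F.corr v w).s b)
    (e₃ : (F.corr u v).t a = (Ψ.psi g v).s (Ψ.sq g v w ⟨(c, b), e₁⟩).1.2)
    (e₄ : (F.corr (γ g u) (γ g v)).t
        (Ψ.sq g u v ⟨((Ψ.sq g v w ⟨(c, b), e₁⟩).1.2, a), e₃⟩).1.1 =
      (F.corr (γ g v) (γ g w)).s (Ψ.sq g v w ⟨(c, b), e₁⟩).1.1)
    (e₅ : (F.corr u w).t (F.comp h₁ h₂ ⟨(b, a), e₂⟩) = (Ψ.psi g w).s c),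
    (Ψ.sq g u w ⟨(c, F.comp h₁ h₂ ⟨(b, a), e₂⟩), e₅⟩).1 =
      (F.comp ((γ g).lt_iff_lt.mpr h₁) ((γ g).lt_iff_lt.mpr h₂)
          ⟨((Ψ.sq g v w ⟨(c, b), e₁⟩).1.1,
            (Ψ.sq g u v ⟨((Ψ.sq g v w ⟨(c, b), e₁⟩).1.2, a), e₃⟩).1.1), e₄⟩,
        (Ψ.sq g u v ⟨((Ψ.sq g v w ⟨(c, b), e₁⟩).1.2, a), e₃⟩).1.2)

/-! ### Stars and star maps -/

section Stars

variable {W : Type v} [NormedAddCommGroup W] [InnerProductSpace ℝ W]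

/-- A star in `W`: a centre and a continuous positive radial function on the unit sphere. -/
structure StarShape (W : Type v) [NormedAddCommGroup W] [InnerProductSpace ℝ W] where
  center : W
  radius : C(Metric.sphere (0 : W) 1, ℝ)
  radius_pos : ∀ θ, 0 < radius θ

namespace StarShape

/-- Stars are topologized by their centre and their radial function. -/
instance : TopologicalSpace (StarShape W) :=
  TopologicalSpace.induced (fun B : StarShape W => (B.center, B.radius)) inferInstance

/-- The subset of `W` described by a star. -/
def carrier (B : StarShape W) : Set W :=
  {p | p = B.center ∨ ∃ (θ : Metric.sphere (0 : W) 1) (α : ℝ),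
    0 ≤ α ∧ α ≤ B.radius θ ∧ p = B.center + α • (θ : W)}

open Classical in
/-- The radial identification of `B` with `B'`: centre to centre, and linear along rays. -/
def radial (B B' : StarShape W) (p : W) : W :=
  if h : p - B.center = 0 then B'.center
  else
    let θ : Metric.sphere (0 : W) 1 :=
      ⟨‖p - B.center‖⁻¹ • (p - B.center), by
        rw [mem_sphere_zero_iff_norm, norm_smul, norm_inv, norm_norm,
          inv_mul_cancel₀ (norm_ne_zero_iff.mpr h)]⟩
    B'.center + (B'.radius θ / B.radius θ) • (p - B.center)

/-- A star centred at `0` whose radial function is invariant under an orthogonal action. -/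
def IsInvariant {G : Type*} [Group G] (ρ : G →* (W ≃ₗᵢ[ℝ] W)) (B : StarShape W) : Prop :=
  B.center = 0 ∧ ∀ (g : G) (θ θ' : Metric.sphere (0 : W) 1),
    (θ' : W) = ρ g θ → B.radius θ' = B.radius θ

end StarShape

/-- The wedge of spheres `(∐ₓ Bₓ) / ∂ = ⋁ₓ Bₓ / ∂Bₓ`.  Its points are the base point `none` and
the points of the interiors of the stars; it carries the quotient topology
(if `W = 0`, each `Bₓ / ∂Bₓ` is a point together with a disjoint base point). -/
def StarWedge {X : Type u} (B : X → StarShape W) : Type (max u v) :=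
  Option (Σ x : X, {p : W // p ∈ interior (B x).carrier})

namespace StarWedge

/-- The base point. -/
def base {X : Type u} (B : X → StarShape W) : StarWedge B := none

open Classical in
/-- The class of the point `p` of the star `Bₓ`. -/
def mk {X : Type u} (B : X → StarShape W) (x : X) (p : W) : StarWedge B :=
  if h : p ∈ interior (B x).carrier then some ⟨x, p, h⟩ else none

/-- The quotient map collapsing the boundaries of the stars to the base point. -/
def collapse {X : Type u} (B : X → StarShape W) : (Unit ⊕ Σ x : X, (B x).carrier) → StarWedge B
  | Sum.inl _ => base B
  | Sum.inr z => mk B z.1 z.2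

instance {X : Type u} (B : X → StarShape W) : TopologicalSpace (StarWedge B) :=
  TopologicalSpace.coinduced (collapse B) inferInstance

/-- The action of `g` on wedges, covering a map `φ` of index sets:
`(x, p) ↦ (φ x, g · φ_{x, φ x}(p))`, where `φ_{x, φ x} : Bₓ → B_{φ x}` is radial. -/
def act {X X' : Type u} (B : X → StarShape W) (B' : X' → StarShape W) (ρg : W ≃ₗᵢ[ℝ] W) (φ : X → X') :
    StarWedge B → StarWedge B'
  | none => base B'
  | some z => mk B' (φ z.1) (ρg ((B z.1).radial (B' (φ z.1)) z.2.1))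

end StarWedge

/-- `Stars({Bₓ}, s)`: families of pairwise disjoint substars `B_a ⊆ B_{s(a)}`. -/
def Stars {X : Type u} {A : Type w} (B : X → StarShape W) (s : A → X) : Type (max v w) :=
  {e : A → StarShape W // (∀ a, (e a).carrier ⊆ (B (s a)).carrier) ∧
    ∀ a a', a ≠ a' → s a = s a' → Disjoint (e a).carrier (e a').carrier}

instance {X : Type u} {A : Type w} (B : X → StarShape W) (s : A → X) :
    TopologicalSpace (Stars B s) := instTopologicalSpaceSubtype

open Classical in
/-- The star map `Φ(e, A) : ⋁ₓ Bₓ / ∂ → ⋁_y B'_y / ∂` refining a correspondence `A`: the complement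
of the interiors of the substars is collapsed to the base point, and the substar `B_a` is
identified radially with `B'_{t(a)}`. -/
def starMap {X Y : Type u} (A : Correspondence.{u, w} X Y) (B : X → StarShape W) (B' : Y → StarShape W)
    (e : A.carrier → StarShape W) : StarWedge B → StarWedge B'
  | none => StarWedge.base B'
  | some z =>
    if h : ∃ a, A.s a = z.1 ∧ z.2.1 ∈ interior (e a).carrier then
      StarWedge.mk B' (A.t h.choose) ((e h.choose).radial (B' (A.t h.choose)) z.2.1)
    else StarWedge.base B'

/-- `D` is a spatial refinement of `F` modeled on `W`, with stars `{Bₓ}` centred at `0`. -/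
structure IsSpatialRefinement {P : Type v} [PartialOrder P] {W : Type*} [NormedAddCommGroup W]
    [InnerProductSpace ℝ W] (F : BurnsideData.{u, v, w} P) (B : ∀ u, F.obj u → StarShape W)
    (D : HCDiagram (fun u => StarWedge (B u)) (fun u => StarWedge.base (B u))) : Prop where
  center_eq_zero : ∀ u x, (B u x).center = 0
  star_family : ∀ u v, v < u → ∃ e : C(FreeHom u v, Stars (B u) (F.corr u v).s),
    ∀ t p, D.map t p = starMap (F.corr u v) (B u) (B v) (e t).1 p

/-- `D` is a `G`-coherent spatial refinement of `F` modeled on the representation `W`. -/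
structure IsCoherentRefinement {G : Type*} [Group G] {P : Type v} [PartialOrder P]
    {W : Type*} [NormedAddCommGroup W] [InnerProductSpace ℝ W] (ρ : G →* (W ≃ₗᵢ[ℝ] W))
    {γ : G →* (P ≃o P)} (F : BurnsideData.{u, v, w} P) (Ψ : ExternalActionData γ F)
    (B : ∀ u, F.obj u → StarShape W)
    (D : HCDiagram (fun u => StarWedge (B u)) (fun u => StarWedge.base (B u))) : Prop
    extends IsSpatialRefinement F B D where
  invariant : ∀ u x, (B u x).IsInvariant ρ
  coherent : ∀ (g : G) (u v : P) (t : FreeHom u v) (p : StarWedge (B u)),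
    StarWedge.act (B v) (B (γ g v)) (ρ g) (Ψ.psi g v).toFun (D.map t p) =
      D.map (t.map (γ g)) (StarWedge.act (B u) (B (γ g u)) (ρ g) (Ψ.psi g u).toFun p)

end Stars

/-! ### `⟨n⟩`-manifolds -/

section Corners

variable {k : ℕ} {X : Type u} [TopologicalSpace X] [ChartedSpace (EuclideanQuadrant k) X]

/-- The number of vanishing coordinates of a point in a chart. -/
def cornerCount (k : ℕ) {X : Type u} [TopologicalSpace X] [ChartedSpace (EuclideanQuadrant k) X]
    (x : X) : ℕ :=
  {j : Fin k | (chartAt (EuclideanQuadrant k) x x).1 j = 0}.ncard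

/-- `S` is the closure of a connected component of `{x ∈ A | c(x) = c}`.  For `A = X`, `c = 1` these
are the facets of `X`; for `A` a multifacet of `X` and `c = 2` they are the facets of `A`. -/
def IsFacetOf (k : ℕ) {X : Type u} [TopologicalSpace X] [ChartedSpace (EuclideanQuadrant k) X]
    (A : Set X) (c : ℕ) (S : Set X) : Prop :=
  ∃ x ∈ A, cornerCount k x = c ∧
    S = closure (connectedComponentIn {y | y ∈ A ∧ cornerCount k y = c} x)

/-- A union of pairwise disjoint facets. -/
def IsMultifacetOf (k : ℕ) {X : Type u} [TopologicalSpace X] [ChartedSpace (EuclideanQuadrant k) X]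
    (A : Set X) (c : ℕ) (S : Set X) : Prop :=
  ∃ 𝓕 : Set (Set X), (∀ T ∈ 𝓕, IsFacetOf k A c T) ∧ 𝓕.PairwiseDisjoint _root_.id ∧ S = ⋃₀ 𝓕

/-- `X`, with the multifacets `bd 1, …, bd n`, is a (smooth) `k`-dimensional `⟨n⟩`-manifold. -/
structure IsCorneredManifold (k : ℕ) (X : Type u) [TopologicalSpace X]
    [ChartedSpace (EuclideanQuadrant k) X] (n : ℕ) (bd : ℕ → Set X) : Prop where
  t2 : T2Space X
  smooth : IsManifold (modelWithCornersEuclideanQuadrant k) ∞ X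
  multifaceted : ∀ x : X, {S | IsFacetOf k Set.univ 1 S ∧ x ∈ S}.encard = cornerCount k x
  multifacet : ∀ i, 1 ≤ i → i ≤ n → IsMultifacetOf k Set.univ 1 (bd i)
  union : ⋃ i ∈ Set.Icc 1 n, bd i = {x | 0 < cornerCount k x}
  inter : ∀ i j, 1 ≤ i → i ≤ n → 1 ≤ j → j ≤ n → i ≠ j →
    IsMultifacetOf k (bd i) 2 (bd i ∩ bd j)

/-- The tangent space at `x` of a union of strata `S` of `X` (through `x`), as a subspace of
the tangent space `T_x X = ℝᵏ`: the span of the directions tangent to `S` in the chart at `x`. -/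
def strataTangent (k : ℕ) {X : Type u} [TopologicalSpace X] [ChartedSpace (EuclideanQuadrant k) X]
    (S : Set X) (x : X) : Submodule ℝ (EuclideanSpace ℝ (Fin k)) :=
  Submodule.span ℝ (tangentConeAt ℝ
    (extChartAt (modelWithCornersEuclideanQuadrant k) x ''
      (S ∩ (extChartAt (modelWithCornersEuclideanQuadrant k) x).source))
    (extChartAt (modelWithCornersEuclideanQuadrant k) x x))

end Corners

/-! ### Virtual representations -/

/-- A finite-dimensional real representation of a group.  (For finite groups it admits an invariant
inner product, unique up to isomorphism.) -/
structure RealRep (K : Type u) [Group K] where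
  V : Type
  [grp : AddCommGroup V]
  [mod : Module ℝ V]
  [fin : FiniteDimensional ℝ V]
  ρ : Representation ℝ K V

attribute [instance] RealRep.grp RealRep.mod RealRep.fin

/-- A formal difference `pos - neg` of representations, representing an element of `RO(K)`. -/
structure VirtualRep (K : Type u) [Group K] where
  pos : RealRep K
  neg : RealRep K

namespace VirtualRep

variable {K : Type u} [Group K] {L : Type v} [Group L]

/-- Direct sum of representations. -/
def _root_.RealRep.add (A B : RealRep K) : RealRep K := ⟨A.V × B.V, A.ρ.prod B.ρ⟩

/-- Restriction of representations along a homomorphism. -/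
def _root_.RealRep.comap (f : L →* K) (A : RealRep K) : RealRep L := ⟨A.V, A.ρ.comp f⟩

/-- A trivial representation. -/
def _root_.RealRep.trivial (K : Type u) [Group K] (n : ℕ) : RealRep K := ⟨Fin n → ℝ, 1⟩

/-- An actual representation, as a virtual one. -/
def of (A : RealRep K) : VirtualRep K := ⟨A, RealRep.trivial K 0⟩

def add (A B : VirtualRep K) : VirtualRep K := ⟨A.pos.add B.pos, A.neg.add B.neg⟩

def comap (f : L →* K) (A : VirtualRep K) : VirtualRep L := ⟨A.pos.comap f, A.neg.comap f⟩

def dim (A : VirtualRep K) : ℤ := Module.finrank ℝ A.pos.V - Module.finrank ℝ A.neg.V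

/-- Equality in `RO(K)`: `V₁ - W₁ ∼ V₂ - W₂` when `V₁ ⊕ W₂ ≅ V₂ ⊕ W₁`. -/
def Rel (A B : VirtualRep K) : Prop :=
  Nonempty (Representation.Equiv (A.pos.add B.neg).ρ (B.pos.add A.neg).ρ)

end VirtualRep

/-! ### Equivariant flow categories -/

/-- A flow category, presented by its moduli spaces `M(x, y)` (the morphism spaces between distinct
objects; `M(x, x)` is empty and `Hom(x, x)` consists of the identity). -/
structure FlowCategory where
  Obj : Type u
  gr : Obj → ℤ
  M : Obj → Obj → Type v
  [top : ∀ x y, TopologicalSpace (M x y)]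
  [charted : ∀ x y, ChartedSpace (EuclideanQuadrant (gr x - gr y - 1).toNat) (M x y)]
  /-- The multifacet `∂ᵢ M(x, y)`, for `1 ≤ i ≤ gr x - gr y - 1`. -/
  bd : ∀ x y, ℕ → Set (M x y)
  comp : ∀ {x y z}, M y z → M x y → M x z
  comp_assoc : ∀ {x y z w} (r : M z w) (q : M y z) (p : M x y),
    comp (comp r q) p = comp r (comp q p)
  gr_lt : ∀ {x y}, M x y → gr y < gr x
  compact : ∀ x y, CompactSpace (M x y)
  manifold : ∀ x y, IsCorneredManifold (gr x - gr y - 1).toNat (M x y)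
    (gr x - gr y - 1).toNat (bd x y)
  /-- The compositions through objects `z` with `gr z = gr y + i` combine to a diffeomorphism of
  `∐_z M(z, y) × M(x, z)` with `∂ᵢ M(x, y)`: they are smooth immersions, and together an embedding
  with image `∂ᵢ M(x, y)`. -/
  comp_smooth : ∀ x y z, ContMDiff
    ((modelWithCornersEuclideanQuadrant (gr z - gr y - 1).toNat).prod
      (modelWithCornersEuclideanQuadrant (gr x - gr z - 1).toNat))
    (modelWithCornersEuclideanQuadrant (gr x - gr y - 1).toNat) ∞
    (fun qp : M z y × M x z => comp qp.1 qp.2)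
  comp_immersion : ∀ x y z (qp : M z y × M x z), Function.Injective (mfderiv
    ((modelWithCornersEuclideanQuadrant (gr z - gr y - 1).toNat).prod
      (modelWithCornersEuclideanQuadrant (gr x - gr z - 1).toNat))
    (modelWithCornersEuclideanQuadrant (gr x - gr y - 1).toNat)
    (fun qp : M z y × M x z => comp qp.1 qp.2) qp)
  comp_embedding : ∀ x y (i : ℕ), 1 ≤ i → (i : ℤ) < gr x - gr y →
    Topology.IsEmbedding
      (fun c : (Σ z : {z // gr z = gr y + i}, M z y × M x z) => comp c.2.1 c.2.2)
  comp_range : ∀ x y (i : ℕ), 1 ≤ i → (i : ℤ) < gr x - gr y →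
    Set.range (fun c : (Σ z : {z // gr z = gr y + i}, M z y × M x z) => comp c.2.1 c.2.2) = bd x y i
  /-- These diffeomorphisms match the multifacets of the product `M(z, y) × M(x, z)` with those
  of `∂ᵢ M(x, y)`, which are its intersections with the other multifacets of `M(x, y)`. -/
  comp_bd_left : ∀ {x y z} (i j : ℕ), gr z = gr y + i → 1 ≤ j → j < i →
    ∀ (q : M z y) (p : M x z), comp q p ∈ bd x y j ↔ q ∈ bd z y j
  comp_bd_right : ∀ {x y z} (i j : ℕ), gr z = gr y + i → i < j → (j : ℤ) < gr x - gr y →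
    ∀ (q : M z y) (p : M x z), comp q p ∈ bd x y j ↔ p ∈ bd x z (j - i)

attribute [instance] FlowCategory.top FlowCategory.charted

namespace FlowCategory

/-- The dimension of `M(x, y)`. -/
abbrev dim (C : FlowCategory.{u, v}) (x y : C.Obj) : ℕ := (C.gr x - C.gr y - 1).toNat

/-- The model with corners of `M(x, y)`. -/
abbrev model (C : FlowCategory.{u, v}) (x y : C.Obj) :
    ModelWithCorners ℝ (EuclideanSpace ℝ (Fin (C.dim x y))) (EuclideanQuadrant (C.dim x y)) :=
  modelWithCornersEuclideanQuadrant (C.dim x y)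

end FlowCategory

/-- The isotropy group of an object, for an action of a group on a set. -/
def isotropy {G : Type w} [Group G] {X : Type u} (act : G →* Equiv.Perm X) (x : X) :
    Subgroup G where
  carrier := {g | act g x = x}
  one_mem' := by simp
  mul_mem' := by
    intro a b ha hb
    simp only [Set.mem_ofPred_eq, map_mul, Equiv.Perm.mul_apply] at *
    rw [hb, ha]
  inv_mem' := by
    intro a ha
    simp only [Set.mem_ofPred_eq, map_inv] at *
    exact Equiv.Perm.inv_eq_iff_eq.mpr ha.symm

/-- Conjugation `k ↦ g⁻¹ k g`, from the isotropy group of `g x` to that of `x`. -/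
def isotropyConj {G : Type w} [Group G] {X : Type u} (act : G →* Equiv.Perm X) (g : G) (x : X) :
    isotropy act (act g x) →* isotropy act x where
  toFun k := ⟨g⁻¹ * k * g, by
    have hk : act k.1 (act g x) = act g x := k.2
    change act (g⁻¹ * k.1 * g) x = x
    simp only [map_mul, map_inv, Equiv.Perm.mul_apply]
    rw [hk]
    simp⟩
  map_one' := by ext; simp
  map_mul' a b := by ext; simp [mul_assoc]

/-- A `G`-equivariant flow category. -/
structure EquivariantFlowCategory (G : Type w) [Group G] extends FlowCategory.{u, v} where
  /-- The functors `𝒢_g`, on objects and on moduli spaces. -/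
  act : G →* Equiv.Perm Obj
  gr_act : ∀ g x, gr (act g x) = gr x
  actM : ∀ (g : G) {x y : Obj}, M x y → M (act g x) (act g y)
  actM_one : ∀ {x y} (p : M x y), (⟨_, _, actM 1 p⟩ : Σ x y, M x y) = ⟨x, y, p⟩
  actM_mul : ∀ (g h : G) {x y} (p : M x y),
    (⟨_, _, actM (g * h) p⟩ : Σ x y, M x y) = ⟨_, _, actM g (actM h p)⟩
  actM_comp : ∀ (g : G) {x y z} (q : M y z) (p : M x y),
    actM g (comp q p) = comp (actM g q) (actM g p)
  /-- With `actM_one` and `actM_mul`: the `𝒢_g` are diffeomorphisms of moduli spaces. -/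
  actM_smooth : ∀ (g : G) (x y : Obj), ContMDiff
    (modelWithCornersEuclideanQuadrant (gr x - gr y - 1).toNat)
    (modelWithCornersEuclideanQuadrant (gr (act g x) - gr (act g y) - 1).toNat) ∞
    (fun p : M x y => actM g p)
  actM_bd : ∀ (g : G) {x y} (i : ℕ), 1 ≤ i → (i : ℤ) < gr x - gr y → ∀ p : M x y,
    actM g p ∈ bd (act g x) (act g y) i ↔ p ∈ bd x y i
  grG : ∀ x, VirtualRep (isotropy act x)
  dim_grG : ∀ x, (grG x).dim = gr x
  grG_act : ∀ g x, (grG (act g x)).Rel ((grG x).comap (isotropyConj act g x))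
  /-- `M(x, y)` is a manifold of dimension `gr_G(x) - gr_G(y) - ℝ`: at each point `p`, for each
  group `H` fixing `p`, the representation of `H` on `T_p M(x, y)` by the derivatives of the `𝒢_h`
  satisfies `[T_p M(x, y)] + ℝ + gr_G(y) = gr_G(x)` in `RO(H)`. -/
  tangent : ∀ (x y : Obj) (p : M x y) (H : Subgroup G) (hx : H ≤ isotropy act x)
    (hy : H ≤ isotropy act y),
    (∀ h ∈ H, (⟨_, _, actM h p⟩ : Σ x y, M x y) = ⟨x, y, p⟩) →
    ∃ τ : Representation ℝ H (Fin (gr x - gr y - 1).toNat → ℝ),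
      (∀ (h : H) (ξ : EuclideanSpace ℝ (Fin (gr x - gr y - 1).toNat))
        (j : Fin (gr x - gr y - 1).toNat)
        (j' : Fin (gr (act h x) - gr (act h y) - 1).toNat), (j : ℕ) = j' →
        τ h (fun i => ξ i) j =
          (show EuclideanSpace ℝ (Fin (gr (act h x) - gr (act h y) - 1).toNat) from
            mfderiv (modelWithCornersEuclideanQuadrant (gr x - gr y - 1).toNat)
              (modelWithCornersEuclideanQuadrant (gr (act h x) - gr (act h y) - 1).toNat)
              (fun p : M x y => actM (h : G) p) p ξ) j') ∧
      (((VirtualRep.of ⟨_, τ⟩).add (VirtualRep.of (RealRep.trivial H 1))).add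
        ((grG y).comap (Subgroup.inclusion hy))).Rel ((grG x).comap (Subgroup.inclusion hx))

/-! ### The cube flow category -/

/-- The cube `{0, 1}ᴺ`, with `1 > 0`. -/
abbrev Cube (N : ℕ) : Type := Fin N → Bool

/-- `|u|`, the number of coordinates equal to `1`. -/
def Cube.abs {N : ℕ} (u : Cube N) : ℕ := (Finset.univ.filter (fun i => u i = true)).card

/-- The action on the cube induced by a permutation action on the coordinates,
`(g u)_i = u_{g⁻¹ i}`. -/
def cubeAction {G : Type w} [Group G] {N : ℕ} (σ : G →* Equiv.Perm (Fin N)) :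
    G →* (Cube N ≃o Cube N) where
  toFun g :=
    { toFun := fun u i => u ((σ g)⁻¹ i)
      invFun := fun u i => u (σ g i)
      left_inv := fun u => by funext i; simp
      right_inv := fun u => by funext i; simp
      map_rel_iff' := by
        intro u v
        constructor
        · intro h i
          have := h (σ g i)
          simpa using this
        · intro h i
          exact h _ }
  map_one' := by ext u i; simp
  map_mul' g h := by
    ext u i
    simp [mul_inv_rev]

/-- The isotropy group of a vertex of the cube. -/
def cubeIsotropy {G : Type w} [Group G] {N : ℕ} (σ : G →* Equiv.Perm (Fin N)) (u : Cube N) :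
    Subgroup G where
  carrier := {g | cubeAction σ g u = u}
  one_mem' := by simp
  mul_mem' := by
    intro a b ha hb
    simp only [Set.mem_ofPred_eq, map_mul, RelIso.mul_apply] at *
    rw [hb, ha]
  inv_mem' := by
    intro a ha
    simp only [Set.mem_ofPred_eq] at *
    have : cubeAction σ a⁻¹ (cubeAction σ a u) = u := by
      rw [← RelIso.mul_apply, ← map_mul]; simp
    rw [ha] at this
    exact this

/-- The permutation representation of the isotropy group of `u` on `ℝ^{i : u_i = 1}`, which is the
equivariant grading of `u` in the cube flow category. -/
def cubeRep {G : Type w} [Group G] {N : ℕ} (σ : G →* Equiv.Perm (Fin N)) (u : Cube N) :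
    RealRep (cubeIsotropy σ u) where
  V := {i // u i = true} → ℝ
  ρ :=
    { toFun := fun h =>
        LinearMap.funLeft ℝ ℝ (fun i : {i // u i = true} =>
          (⟨(σ h.1)⁻¹ i.1, by
            have h1 : cubeAction σ h.1 u = u := h.2
            have h2 := congrFun h1 i.1
            exact h2.trans i.2⟩ : {i // u i = true}))
      map_one' := by ext; simp [LinearMap.funLeft]
      map_mul' := fun a b => by ext; simp [LinearMap.funLeft, mul_inv_rev] }

/-- The multifacet `∂ᵢ` of the space of morphisms `u ⟶ v` of the cube flow category: the composites
through vertices `w` with `|w| = |v| + i`. -/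
def cubeFacet {N : ℕ} (u v : Cube N) (i : ℕ) : Set (FreeHom u v) :=
  {t | ∃ w, v < w ∧ w < u ∧ w.abs = v.abs + i ∧ t.1 w = 0}

open Classical in
/-- For a chain `T` in `(v, u)`, the barycentre of the corresponding face of the permutohedron (the
convex hull of the orderings of `|v| + 1, …, |u|` by the coordinates `i` with `v_i = 0`,
`u_i = 1`): the `i`-th coordinate is the average of `a + 1, …, b`, where `b` is the least `|w|` with
`w ∈ T ∪ {u}`, `w_i = 1`, and `a` the largest `|w|` with `w ∈ T ∪ {v}`, `w_i = 0`. The remaining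
coordinates are set to `0`. -/
def faceBarycentre {N : ℕ} (u v : Cube N) (T : Finset (Cube N)) (i : Fin N) : ℝ :=
  if u i = true ∧ v i = false then
    (((((insert v T).filter (fun w => w i = false)).sup Cube.abs : ℕ) : ℝ) +
      ((sInf {k : ℕ | ∃ w ∈ insert u T, w i = true ∧ w.abs = k} : ℕ) : ℝ) + 1) / 2
  else 0

/-- The identification of the cubical complex of morphisms `u ⟶ v` with the cubical subdivision
of the permutohedron, cube by cube: the cube of a chain is mapped by multilinear interpolation of
the barycentres of the faces given by its subchains, absent members being those of parameter `1`.
It defines the smooth structure of the cube flow category, as a subset of `ℝᴺ`. -/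
def permutohedralMap {N : ℕ} {u v : Cube N} (t : FreeHom u v) : Fin N → ℝ :=
  fun i => ∑ T : Finset (Cube N),
    ((∏ w ∈ T, (1 - (t.1 w : ℝ))) * ∏ w ∈ Finset.univ \ T, (t.1 w : ℝ)) * faceBarycentre u v T i

/-- A `G`-equivariant cubical flow category: a `G`-equivariant flow category with a `G`-cover
`f : Σ^V 𝒞 → C_σ(N)` of the cube flow category. -/
structure EquivariantCubicalFlowCategory {G : Type w} [Group G] {N : ℕ}
    (σ : G →* Equiv.Perm (Fin N)) extends EquivariantFlowCategory.{u, v, w} G where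
  /-- The virtual representation `V` of the suspension. -/
  susp : VirtualRep G
  f : Obj → Cube N
  fM : ∀ {x y : Obj}, M x y → FreeHom (f x) (f y)
  fM_comp : ∀ {x y z : Obj} (q : M y z) (p : M x y), fM (comp q p) = (fM q).comp (fM p)
  f_act : ∀ g x, f (act g x) = cubeAction σ g (f x)
  fM_act : ∀ g {x y} (p : M x y), (fM (actM g p)).1 = ((fM p).map (cubeAction σ g)).1
  covering : ∀ x y, IsCoveringMap (fun p : M x y => fM p)
  /-- `gr_G(x) + V = gr_G(f x)` in `RO(G_x)`. -/
  grG_f : ∀ x (hx : isotropy act x ≤ cubeIsotropy σ (f x)),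
    ((grG x).add (susp.comap (isotropy act x).subtype)).Rel
      (VirtualRep.of ((cubeRep σ (f x)).comap (Subgroup.inclusion hx)))

/-! ### The Burnside functor with external action of an equivariant cubical flow category -/

/-- The map of path components induced by a continuous map. -/
def pathComponentsMap {X : Type u} {Y : Type v} [TopologicalSpace X] [TopologicalSpace Y]
    (φ : X → Y) (hφ : Continuous φ) : ZerothHomotopy X → ZerothHomotopy Y :=
  Quotient.map φ (by rintro _ _ ⟨γ⟩; exact ⟨γ.map hφ⟩)

namespace EquivariantCubicalFlowCategory

variable {G : Type w} [Group G] {N : ℕ} {σ : G →* Equiv.Perm (Fin N)}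
  (C : EquivariantCubicalFlowCategory.{u, v, w} σ)

/-- `F(u) = f⁻¹(u)`. -/
abbrev Fib (a : Cube N) : Type u := {x : C.Obj // C.f x = a}

/-- Composition on path components of moduli spaces. -/
def compPi {x y z : C.Obj} : ZerothHomotopy (C.M y z) → ZerothHomotopy (C.M x y) →
    ZerothHomotopy (C.M x z) :=
  Quotient.map₂ (fun q p => C.comp q p) (by
    rintro q q' ⟨γ⟩ p p' ⟨δ⟩
    exact ⟨(γ.prod δ).map (C.comp_smooth x z y).continuous⟩)

/-- The associated Burnside functor: `F(u) = f⁻¹(u)`, `F(u, v)` is the set of path components of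
`∐ M(x, y)` over `f(x) = u`, `f(y) = v`, and `F(u, v, w)` is induced by composition. -/
def burnside : BurnsideData.{u, 0, max u v} (Cube N) where
  obj := C.Fib
  corr a b :=
    { carrier := Σ (x : C.Fib a) (y : C.Fib b), ZerothHomotopy (C.M x.1 y.1)
      s := fun c => c.1
      t := fun c => c.2.1 }
  comp := fun _ _ z =>
    ⟨z.1.2.1, z.1.1.2.1, C.compPi z.1.1.2.2
      (cast (congrArg (fun y => ZerothHomotopy (C.M z.1.2.1.1 y)) (congrArg Subtype.val z.2))
        z.1.2.2.2)⟩

/-- `φ_{g, v} : F(v) → F(gv)`, the restriction of `𝒢_g`. -/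
def fibMap (g : G) (a : Cube N) (x : C.Fib a) : C.Fib (cubeAction σ g a) :=
  ⟨C.act g x.1, by rw [C.f_act, x.2]⟩

theorem fibMap_bijective (g : G) (a : Cube N) : Function.Bijective (C.fibMap g a) := by
  constructor
  · intro x y h
    exact Subtype.ext ((C.act g).injective (congrArg Subtype.val h))
  · rintro ⟨y, hy⟩
    refine ⟨⟨(C.act g).symm y, (cubeAction σ g).injective ?_⟩, Subtype.ext ?_⟩
    · rw [← C.f_act, Equiv.apply_symm_apply, hy]
    · simp [fibMap]

/-- `φ_{g, u, v} : F(u, v) → F(gu, gv)`, induced by `𝒢_g` on path components. -/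
def corrMap (g : G) (a b : Cube N) (c : (C.burnside.corr a b).carrier) :
    (C.burnside.corr (cubeAction σ g a) (cubeAction σ g b)).carrier :=
  ⟨C.fibMap g a c.1, C.fibMap g b c.2.1,
    pathComponentsMap (fun p => C.actM g p) (C.actM_smooth g c.1.1 c.2.1.1).continuous c.2.2⟩

/-- The associated external action: `ψ_{g, v}` is the graph of `φ_{g, v}`, and the 2-morphisms
are `x ↦ (φ_{h, v}(x), x)` and `(t(a), a) ↦ (φ_{g, u, v}(a), s(a))`. -/
def externalAction : ExternalActionData (cubeAction σ) C.burnside where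
  psi g a :=
    { carrier := C.Fib a
      s := _root_.id
      t := C.fibMap g a
      s_bijective := Function.bijective_id
      t_bijective := C.fibMap_bijective g a }
  two _ h a x := ⟨(C.fibMap h a x, x), rfl⟩
  sq g a b z := ⟨(C.corrMap g a b z.1.2, z.1.2.1), rfl⟩

end EquivariantCubicalFlowCategory

/-! ### Framed equivariant cubical neat embeddings -/

/-- The indices of the summands of `V^{e_0} ⊕ ⋯ ⊕ V^{e_{N-1}}`. -/
abbrev LevelIndex {N : ℕ} (e : Fin N → ℕ) : Type := Σ i : Fin N, Fin (e i)

/-- The inner product space `V^{e_0} ⊕ ⋯ ⊕ V^{e_{N-1}}`. -/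
abbrev LevelSum (V : Type v) [NormedAddCommGroup V] [InnerProductSpace ℝ V] {N : ℕ}
    (e : Fin N → ℕ) : Type v :=
  PiLp 2 (fun _ : LevelIndex e => V)

/-- The diagonal action on `V^{e_0} ⊕ ⋯ ⊕ V^{e_{N-1}}`. -/
def diagonalRep {G : Type w} [Group G] {V : Type v} [NormedAddCommGroup V] [InnerProductSpace ℝ V]
    (ρ : G →* (V ≃ₗᵢ[ℝ] V)) {N : ℕ} (e : Fin N → ℕ) :
    G →* (LevelSum V e ≃ₗᵢ[ℝ] LevelSum V e) where
  toFun g := LinearIsometryEquiv.piLpCongrRight 2 (fun _ => ρ g)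
  map_one' := by ext x k; simp
  map_mul' g h := by ext x k; simp

/-- `∏_{|v| ≤ i < |u|} B_r(V)^{e_i}`, as the set of those vectors of `V^{e_0} ⊕ ⋯ ⊕ V^{e_{N-1}}`
whose other components vanish. -/
def levelBox {V : Type v} [NormedAddCommGroup V] [InnerProductSpace ℝ V] {N : ℕ}
    (e : Fin N → ℕ) (r : ℝ) (a b : Cube N) : Set (LevelSum V e) :=
  {z | ∀ k : LevelIndex e, (b.abs ≤ k.1 ∧ (k.1 : ℕ) < a.abs → ‖z k‖ ≤ r) ∧
    (¬ (b.abs ≤ k.1 ∧ (k.1 : ℕ) < a.abs) → z k = 0)}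

/-- The stratum `⋂_{i ∈ S} ∂ᵢ` of `E(V)_{a, b} = ∏_{|b| ≤ i < |a|} B_R(V)^{e_i} × C_σ(N)(a, b)`, as a
subset of the vector space containing it. -/
def ambientStratum {V : Type v} [NormedAddCommGroup V] [InnerProductSpace ℝ V] {N : ℕ}
    (e : Fin N → ℕ) (R : ℝ) (a b : Cube N) (S : Set ℕ) : Set (LevelSum V e × (Fin N → ℝ)) :=
  {q | q.1 ∈ levelBox e R a b ∧ ∃ t : FreeHom a b, (∀ i ∈ S, t ∈ cubeFacet a b i) ∧
    q.2 = permutohedralMap t}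

section NeatEmbedding

variable {G : Type w} [Group G] {N : ℕ} {σ : G →* Equiv.Perm (Fin N)}

/-- An equivariant cubical neat embedding of `𝒞` relative to the representation `V` and the sequence
`e`.  The embedding `ι_{x, y} : M(x, y) → E(V)_{f x, f y}` is `p ↦ (vec p, f p)`, its second
component being prescribed. -/
structure EquivariantNeatEmbedding (C : EquivariantCubicalFlowCategory.{u, v, w} σ)
    {V : Type*} [NormedAddCommGroup V] [InnerProductSpace ℝ V] (ρ : G →* (V ≃ₗᵢ[ℝ] V))
    (e : Fin N → ℕ) (R : ℝ) where
  vec : ∀ {x y : C.Obj}, C.M x y → LevelSum V e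
  vec_mem : ∀ {x y : C.Obj} (p : C.M x y), vec p ∈ levelBox e R (C.f x) (C.f y)
  smooth : ∀ x y, ContMDiff (C.model x y) 𝓘(ℝ, LevelSum V e × (Fin N → ℝ)) ∞
    (fun p : C.M x y => (vec p, permutohedralMap (C.fM p)))
  immersion : ∀ x y (p : C.M x y), Function.Injective
    (mfderiv (C.model x y) 𝓘(ℝ, LevelSum V e × (Fin N → ℝ))
      (fun p : C.M x y => (vec p, permutohedralMap (C.fM p))) p)
  /-- The `ι_{x, y}` over given vertices `a`, `b` are together a topological embedding. -/
  embedding : ∀ a b : Cube N, Topology.IsEmbedding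
    (fun c : (Σ (x : C.Fib a) (y : C.Fib b), C.M x.1 y.1) => (vec c.2.2, (C.fM c.2.2).1))
  preimage_facet : ∀ {x y} (i : ℕ), 1 ≤ i → (i : ℤ) < C.gr x - C.gr y → ∀ p : C.M x y,
    C.fM p ∈ cubeFacet (C.f x) (C.f y) i ↔ p ∈ C.bd x y i
  /-- A Riemannian metric on `E(V)_{a, b}` (restricted from the vector space containing it). -/
  metric : Cube N → Cube N → LevelSum V e × (Fin N → ℝ) →
    LinearMap.BilinForm ℝ (LevelSum V e × (Fin N → ℝ))
  metric_smooth : ∀ a b ξ η, ContDiff ℝ ∞ (fun q => metric a b q ξ η)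
  metric_symm : ∀ a b q ξ η, metric a b q ξ η = metric a b q η ξ
  metric_pos : ∀ a b q ξ, ξ ≠ 0 → 0 < metric a b q ξ ξ
  /-- For strata `X(T) ⊆ X(S)` of `X = M(x, y)`, `S ⊆ T`, the image of `X(S)` is perpendicular to the
  stratum `Y(T)` of `Y = E(V)`: tangent vectors to `X(S)` that are normal to `X(T)` are mapped to
  vectors that are normal to `Y(T)`. -/
  perpendicular : ∀ {x y} (p : C.M x y) (S T : Set ℕ), S ⊆ T →
    T ⊆ {i | 1 ≤ i ∧ (i : ℤ) < C.gr x - C.gr y} → (∀ i ∈ T, p ∈ C.bd x y i) →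
    ∀ ξ ∈ strataTangent (C.dim x y) (⋂ i ∈ S, C.bd x y i) p,
    (∀ η ∈ strataTangent (C.dim x y) (⋂ i ∈ T, C.bd x y i) p,
      metric (C.f x) (C.f y) (vec p, permutohedralMap (C.fM p))
        (mfderiv (C.model x y) 𝓘(ℝ, LevelSum V e × (Fin N → ℝ))
          (fun p : C.M x y => (vec p, permutohedralMap (C.fM p))) p ξ)
        (mfderiv (C.model x y) 𝓘(ℝ, LevelSum V e × (Fin N → ℝ))
          (fun p : C.M x y => (vec p, permutohedralMap (C.fM p))) p η) = 0) →
    ∀ ζ ∈ tangentConeAt ℝ (ambientStratum e R (C.f x) (C.f y) T)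
        (vec p, permutohedralMap (C.fM p)),
      metric (C.f x) (C.f y) (vec p, permutohedralMap (C.fM p))
        (mfderiv (C.model x y) 𝓘(ℝ, LevelSum V e × (Fin N → ℝ))
          (fun p : C.M x y => (vec p, permutohedralMap (C.fM p))) p ξ) ζ = 0
  /-- Compatibility with composition, `E(V)` being composed by merging the factors. -/
  vec_comp : ∀ {x y z} (q : C.M y z) (p : C.M x y), vec (C.comp q p) = vec q + vec p
  vec_act : ∀ g {x y} (p : C.M x y), vec (C.actM g p) = diagonalRep ρ e g (vec p)

/-- A framed equivariant cubical neat embedding: `ι` is extended by translation to the maps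
`ῑ_{x, y} : ∏_{|f y| ≤ i < |f x|} B_ε(V)^{e_i} × M(x, y) → E(V)_{f x, f y}`,
`(a, p) ↦ (a + vec p, f p)`, which have to be embeddings, jointly over given vertices. -/
structure FramedNeatEmbedding (C : EquivariantCubicalFlowCategory.{u, v, w} σ)
    {V : Type*} [NormedAddCommGroup V] [InnerProductSpace ℝ V] (ρ : G →* (V ≃ₗᵢ[ℝ] V))
    (e : Fin N → ℕ) (R ε : ℝ) extends EquivariantNeatEmbedding C ρ e R where
  framed_mem : ∀ {x y : C.Obj} (p : C.M x y), ∀ a ∈ levelBox e ε (C.f x) (C.f y),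
    a + vec p ∈ levelBox e R (C.f x) (C.f y)
  framed_embedding : ∀ a b : Cube N, Topology.IsEmbedding
    (fun c : (Σ (x : C.Fib a) (y : C.Fib b), (levelBox (V := V) e ε a b) × C.M x.1 y.1) =>
      ((c.2.2.1 : LevelSum V e) + vec c.2.2.2, (C.fM c.2.2.2).1))

end NeatEmbedding

/-! ### The homotopy coherent diagram of a framed neat embedding -/

/-- The star `∏_k B_{r_k}(V)` in `V^ι`, centred at `c`. -/
def boxStar {J : Type} [Fintype J] {V : Type v} [NormedAddCommGroup V] [InnerProductSpace ℝ V]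
    (r : J → ℝ) (hr : ∀ k, 0 < r k) (c : PiLp 2 (fun _ : J => V)) :
    StarShape (PiLp 2 (fun _ : J => V)) :=
  have key : ∀ θ : Metric.sphere (0 : PiLp 2 (fun _ : J => V)) 1,
      0 < ‖fun k => (r k)⁻¹ • θ.1 k‖ := by
    intro θ
    rw [norm_pos_iff]
    intro h
    have h0 : θ.1 = 0 := by
      ext k
      have := congrFun h k
      simpa [(hr k).ne'] using this
    have h1 := mem_sphere_zero_iff_norm.mp θ.2
    rw [h0, norm_zero] at h1
    exact zero_ne_one h1
  { center := c
    radius := ⟨fun θ => ‖fun k => (r k)⁻¹ • θ.1 k‖⁻¹, by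
      refine Continuous.inv₀ (Continuous.norm ?_) (fun θ => (key θ).ne')
      exact continuous_pi fun k =>
        ((PiLp.continuous_apply 2 _ k).comp continuous_subtype_val).const_smul _⟩
    radius_pos := fun θ => inv_pos.mpr (key θ) }

theorem mem_boxStar {J : Type} [Fintype J] {V : Type v} [NormedAddCommGroup V]
    [InnerProductSpace ℝ V] (r : J → ℝ) (hr : ∀ k, 0 < r k) (c p : PiLp 2 (fun _ : J => V)) :
    p ∈ (boxStar r hr c).carrier ↔ ∀ k, ‖p k - c k‖ ≤ r k := by
  constructor
  · rintro (rfl | ⟨θ, α, h0, h1, rfl⟩) k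
    · simpa [boxStar] using (hr k).le
    · have hpos : 0 < ‖fun k => (r k)⁻¹ • θ.1 k‖ := inv_pos.mp ((boxStar r hr c).radius_pos θ)
      change α ≤ ‖fun k => (r k)⁻¹ • θ.1 k‖⁻¹ at h1
      have h2 : ‖(r k)⁻¹ • θ.1 k‖ ≤ ‖fun k => (r k)⁻¹ • θ.1 k‖ :=
        norm_le_pi_norm (fun k => (r k)⁻¹ • θ.1 k) k
      rw [norm_smul, Real.norm_of_nonneg (inv_pos.mpr (hr k)).le, inv_mul_le_iff₀ (hr k)] at h2
      have h3 : α * ‖fun k => (r k)⁻¹ • θ.1 k‖ ≤ 1 := by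
        calc _ ≤ ‖fun k => (r k)⁻¹ • θ.1 k‖⁻¹ * ‖fun k => (r k)⁻¹ • θ.1 k‖ := by gcongr
          _ = 1 := inv_mul_cancel₀ hpos.ne'
      have h4 : ((boxStar r hr c).center + α • θ.1) k - c k = α • θ.1 k := by
        simp [boxStar]
      rw [h4, norm_smul, Real.norm_of_nonneg h0]
      calc α * ‖θ.1 k‖ ≤ α * (r k * ‖fun k => (r k)⁻¹ • θ.1 k‖) := by gcongr
        _ = r k * (α * ‖fun k => (r k)⁻¹ • θ.1 k‖) := by ring
        _ ≤ r k * 1 := mul_le_mul_of_nonneg_left h3 (hr k).le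
        _ = r k := mul_one _
  · intro h
    by_cases hp : p - c = 0
    · exact Or.inl (sub_eq_zero.mp hp)
    · right
      have hn : 0 < ‖p - c‖ := norm_pos_iff.mpr hp
      let θ : Metric.sphere (0 : PiLp 2 (fun _ : J => V)) 1 :=
        ⟨‖p - c‖⁻¹ • (p - c), by
          rw [mem_sphere_zero_iff_norm, norm_smul, norm_inv, norm_norm, inv_mul_cancel₀ hn.ne']⟩
      have hpos : 0 < ‖fun k => (r k)⁻¹ • θ.1 k‖ := inv_pos.mp ((boxStar r hr c).radius_pos θ)
      refine ⟨θ, ‖p - c‖, hn.le, ?_, ?_⟩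
      · change ‖p - c‖ ≤ ‖fun k => (r k)⁻¹ • θ.1 k‖⁻¹
        rw [le_inv_comm₀ hn hpos, pi_norm_le_iff_of_nonneg (inv_pos.mpr hn).le]
        intro k
        have h1 : θ.1 k = ‖p - c‖⁻¹ • (p k - c k) := by simp [θ]
        rw [h1, norm_smul, norm_smul, norm_inv, norm_inv, norm_norm,
          Real.norm_of_nonneg (hr k).le, ← mul_assoc, mul_comm (r k)⁻¹, mul_assoc]
        refine mul_le_of_le_one_right (inv_pos.mpr hn).le ?_
        rw [inv_mul_le_iff₀ (hr k), mul_one]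
        exact h k
      · change p = c + ‖p - c‖ • (‖p - c‖⁻¹ • (p - c))
        rw [smul_smul, mul_inv_cancel₀ hn.ne', one_smul, add_sub_cancel]

namespace FramedNeatEmbedding

variable {G : Type w} [Group G] {N : ℕ} {σ : G →* Equiv.Perm (Fin N)}
  {C : EquivariantCubicalFlowCategory.{u, v, w} σ}
  {V : Type*} [NormedAddCommGroup V] [InnerProductSpace ℝ V] {ρ : G →* (V ≃ₗᵢ[ℝ] V)}
  {e : Fin N → ℕ} {R ε : ℝ}

/-- The radii of `B_x = ∏_{i < |u|} B_R(V)^{e_i} × ∏_{|u| ≤ i} B_ε(V)^{e_i}`, where `u = f(x)`. -/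
def radii (R ε : ℝ) {e : Fin N → ℕ} (a : Cube N) (k : LevelIndex e) : ℝ :=
  if (k.1 : ℕ) < a.abs then R else ε

theorem radii_pos (hR : 0 < R) (hε : 0 < ε) (a : Cube N) (k : LevelIndex e) :
    0 < radii R ε a k := by
  unfold radii; split_ifs <;> assumption

/-- The stars `B_x`, for `x ∈ F(u) = f⁻¹(u)`. -/
def box (_ι : FramedNeatEmbedding C ρ e R ε) (hR : 0 < R) (hε : 0 < ε) (a : Cube N) :
    C.burnside.obj a → StarShape (LevelSum V e) :=
  fun _ => boxStar (radii R ε a) (radii_pos hR hε a) 0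

open Classical in
/-- The star arrangement given by `ῑ` over `t ∈ C_σ(N)(u, v)`: to the path component `c` of
`M(x, y)` it assigns the image of `B_y` under `ῑ` (extended by the identity to the remaining
factors) at the point `p` of `c` over `t`, that is, the translate of `B_y` by `vec p`. -/
def arrangement (ι : FramedNeatEmbedding C ρ e R ε) (hR : 0 < R) (hε : 0 < ε) {a b : Cube N}
    (t : FreeHom a b) (c : (C.burnside.corr a b).carrier) : StarShape (LevelSum V e) :=
  boxStar (radii R ε b) (radii_pos hR hε b)
    (if h : ∃ p : C.M c.1.1 c.2.1.1, ZerothHomotopy.mk p = c.2.2 ∧ (C.fM p).1 = t.1 then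
      ι.vec h.choose else 0)

/-- `D` is the homotopy coherent diagram of `ι`: its spaces are the wedges `⋁ B_x / ∂B_x`, and for
`u > v` its map over `t ∈ C_σ(N)(u, v)` is the star map `Φ(ῑ_{u, v}(t), F(u, v))`, where
`ῑ_{u, v}` is a continuous family of star arrangements. -/
def IsDiagram (ι : FramedNeatEmbedding C ρ e R ε) (hR : 0 < R) (hε : 0 < ε)
    (D : HCDiagram (fun a => StarWedge (ι.box hR hε a))
      (fun a => StarWedge.base (ι.box hR hε a))) : Prop :=
  ∀ a b : Cube N, b < a →
    ∃ E : C(FreeHom a b, Stars (ι.box hR hε a) (C.burnside.corr a b).s),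
      (∀ t, (E t).1 = ι.arrangement hR hε t) ∧
      ∀ t p, D.map t p = starMap (C.burnside.corr a b) (ι.box hR hε a) (ι.box hR hε b) (E t).1 p

end FramedNeatEmbedding

end

/-! The morphism spaces of the cube flow category are contractible: raising all parameters to `1`
shrinks any chain to the empty one. Hence the covering `C.fM` is trivial over each of them, and a
path component of `M(x, y)` contains exactly one point over each `t`, depending continuously on `t`
(`eq_of_mk_eq`, `exists_section`). So each label of the correspondence over `t` is a point of a
moduli space, and its star is the box of the target translated by the vector of that point
(`arrangement_eq`).

Composition in the moduli spaces induces a bijection on components (`burnside_comp_bijective`). Take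
the point of a component of `M(x, z)` over a composite through `b`. It lies in the corresponding
multifacet, since multifacets are preimages of cubical ones, so it is a composite through some
object `y`. A chain has at most one member with a given number of ones, so `y` lies over `b`.
Uniqueness of the factorization is the injectivity of the embedding onto the multifacet. Comparing
levels needs gradings to differ exactly as `Cube.abs` does (`gr_sub_gr`).

The target box and a star mapped to it have the same radii, so the radial identification is the
translation `p ↦ p - c` (`radial_boxStar`). The laws of the diagram thereby become identities
between centres: they add under composition (`starVec_comp`) and are permuted linearly by the group
(`starVec_corrMap`). What remains is to follow the points collapsed to the base point; disjointness
of the stars and the bijections between labels handle these (`starMap_comp`, `act_starMap`).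

Containment and disjointness of the stars express that the translated framing is well defined and
injective (`arrangement_subset`, `arrangement_disjoint`). Joint continuity follows from gluing
finitely many continuous pieces on closed sets (`continuous_starMap_boxStar`). -/

/-! ### Coverings of contractible spaces -/

namespace IsCoveringMap

open scoped unitInterval

variable {E X : Type*} [TopologicalSpace E] [TopologicalSpace X] {p : E → X}

/-- Over a simply connected base, a point of the total space is determined by its path component
and its image. -/
theorem eq_of_joined [SimplyConnectedSpace X] (hp : IsCoveringMap p) {e e' : E} (h : Joined e e')
    (he : p e = p e') : e = e' := by
  obtain ⟨γ⟩ := h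
  let δ : Path (p e) (p e) := (γ.map hp.continuous).cast rfl he
  have h0 : (δ : C(I, X)) 0 = p e := δ.source
  -- The image of the joining path is a null-homotopic loop. Its lift from `e` therefore ends where
  -- the lift of the constant loop does, namely at `e`; but that lift is the joining path itself.
  have hδ : (δ : C(I, X)).HomotopicRel (Path.refl (p e) : Path (p e) (p e)) {0, 1} :=
    SimplyConnectedSpace.paths_homotopic δ (Path.refl _)
  have h1 := hp.liftPath_apply_one_eq_of_homotopicRel hδ e h0 rfl
  have h2 : (γ : C(I, E)) = hp.liftPath δ e h0 :=
    (hp.eq_liftPath_iff' h0).mpr ⟨rfl, γ.source⟩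
  have h3 : hp.liftPath (Path.refl (p e) : Path (p e) (p e)) e rfl = .const I e :=
    hp.liftPath_const rfl
  rw [← h2, h3] at h1
  exact h1.symm.trans γ.target

/-- A covering of a contractible space has a section through each path component. -/
theorem exists_section_joined [ContractibleSpace X] (hp : IsCoveringMap p) (e : E) :
    ∃ s : C(X, E), (∀ x, p (s x) = x) ∧ ∀ x, Joined e (s x) := by
  obtain ⟨c, ⟨H⟩⟩ := id_nullhomotopic X
  obtain ⟨γ⟩ := PathConnectedSpace.joined (p e) c
  -- Move from `p e` to the contraction point along `γ`, then run the contraction backwards. Lifting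
  -- this homotopy from the constant map `e` gives the section at time `1`, and the track of each
  -- `x` joins `e` to its value.
  have K : (ContinuousMap.const X (p e)).Homotopy (ContinuousMap.id X) :=
    ContinuousMap.Homotopy.trans
      { toFun := fun z => γ z.1
        map_zero_left := by simp
        map_one_left := by simp } H.symm
  have h0 : ∀ x, K.toContinuousMap (0, x) = p (ContinuousMap.const X e x) := fun x => K.apply_zero x
  let L := hp.liftHomotopy K.toContinuousMap (ContinuousMap.const X e) h0
  have hL : ∀ z, p (L z) = K.toContinuousMap z := fun z =>
    congrFun (hp.liftHomotopy_lifts K.toContinuousMap (ContinuousMap.const X e) h0) z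
  refine ⟨⟨fun x => L (1, x), by fun_prop⟩, fun x => ?_, fun x => ⟨?_⟩⟩
  · exact (hL (1, x)).trans (K.apply_one x)
  · exact ⟨⟨fun s => L (s, x), by fun_prop⟩,
      hp.liftHomotopy_zero K.toContinuousMap (ContinuousMap.const X e) h0 x, rfl⟩

end IsCoveringMap

/-! ### Morphism spaces of the free topological category -/

namespace FreeHom

variable {P : Type u} [PartialOrder P] {a b c d : P}

/-- In this form being a chain is an intersection of closed conditions on pairs of parameters. -/
theorem chain_iff (t : P → unitInterval) : IsChain (· ≤ ·) {w | t w < 1} ↔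
    ∀ x y, ¬ (x ≤ y ∨ y ≤ x) → t x = 1 ∨ t y = 1 := by
  constructor
  · intro h x y hxy
    by_contra! hc
    refine hxy (h (unitInterval.lt_one_iff_ne_one.mpr hc.1)
      (unitInterval.lt_one_iff_ne_one.mpr hc.2) ?_)
    rintro rfl
    exact hxy (Or.inl le_rfl)
  · intro h x hx y hy _
    by_contra hc
    rcases h x y hc with h1 | h1
    · exact hx.ne h1
    · exact hy.ne h1

theorem isClosed_setOf (a b : P) : IsClosed {t : P → unitInterval | b ≤ a ∧
    (∀ w, ¬ (b < w ∧ w < a) → t w = 1) ∧ IsChain (· ≤ ·) {w | t w < 1}} := by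
  simp only [chain_iff, Set.ofPred_and, Set.ofPred_forall]
  refine isClosed_const.inter (IsClosed.inter ?_ ?_)
  · exact isClosed_iInter fun w => isClosed_iInter fun _ =>
      isClosed_eq (continuous_apply w) continuous_const
  · refine isClosed_iInter fun x => isClosed_iInter fun y => isClosed_iInter fun _ => ?_
    exact (isClosed_eq (continuous_apply x) continuous_const).union
      (isClosed_eq (continuous_apply y) continuous_const)

/-- Compactness and the Hausdorff property together give the local compactness under which a product
with a quotient map is again a quotient map. -/
instance (a b : P) : CompactSpace (FreeHom a b) :=
  isCompact_iff_compactSpace.mp (isClosed_setOf a b).isCompact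

instance (a b : P) : T2Space (FreeHom a b) := inferInstanceAs (T2Space {_t // _})

/-- The morphism with empty chain. -/
def top (h : b ≤ a) : FreeHom a b :=
  ⟨fun _ => 1, h, fun _ _ => rfl, by intro x hx; simp at hx⟩

/-- Raising all parameters to at least `r`. -/
def raise (r : unitInterval) (t : FreeHom a b) : FreeHom a b :=
  ⟨fun x => max r (t.1 x), t.le, fun x hx => by
      change max r (t.1 x) = 1
      exact (congrArg (max r) (t.2.2.1 x hx)).trans (max_eq_right r.2.2), by
      intro x hx y hy hxy
      have hx' : max r (t.1 x) < 1 := hx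
      have hy' : max r (t.1 y) < 1 := hy
      exact t.2.2.2 (max_lt_iff.mp hx').2 (max_lt_iff.mp hy').2 hxy⟩

/-- Raising parameters only removes members from a chain, so `raise r` stays in the space; it runs
from the identity at `r = 0` to the empty chain at `r = 1`. -/
theorem contractibleSpace (h : b ≤ a) : ContractibleSpace (FreeHom a b) := by
  rw [contractible_iff_id_nullhomotopic]
  refine ⟨top h, ⟨⟨⟨fun z => raise z.1 z.2, ?_⟩, ?_, ?_⟩⟩⟩
  · refine Continuous.subtype_mk (continuous_pi fun x => ?_) _
    exact continuous_fst.max ((continuous_apply x).comp (continuous_subtype_val.comp continuous_snd))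
  · intro t
    exact Subtype.ext (funext fun x => max_eq_right (t.1 x).2.1)
  · intro t
    exact Subtype.ext (funext fun x => max_eq_left (t.1 x).2.2)

theorem eq_id (t : FreeHom a a) : t = FreeHom.id a :=
  Subtype.ext (funext fun x => t.2.2.1 x fun h => lt_asymm h.1 h.2)

theorem id_comp (t : FreeHom a b) : (FreeHom.id b).comp t = t :=
  Subtype.ext (funext fun x => by
    simp only [comp, FreeHom.id, lt_irrefl, false_and, and_false, if_false]
    exact min_eq_right (t.1 x).2.2)

theorem comp_id (t : FreeHom a b) : t.comp (FreeHom.id a) = t :=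
  Subtype.ext (funext fun x => by
    simp only [comp, FreeHom.id, lt_irrefl, and_false, if_false]
    exact min_eq_left (t.1 x).2.2)

theorem comp_apply_mid (s : FreeHom b c) (t : FreeHom a b) (h₁ : c < b) (h₂ : b < a) :
    (s.comp t).1 b = 0 := by
  simp [comp, h₁, h₂]

end FreeHom

/-! ### Star maps -/

section StarMaps

variable {W : Type v} [NormedAddCommGroup W] [InnerProductSpace ℝ W]

namespace StarWedge

theorem isQuotientMap_collapse {X : Type u} (B : X → StarShape W) :
    Topology.IsQuotientMap (collapse B) := by
  refine ⟨⟨rfl⟩, ?_⟩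
  rintro (_ | ⟨x, p, h⟩)
  · exact ⟨Sum.inl (), rfl⟩
  · exact ⟨Sum.inr ⟨x, p, interior_subset h⟩, dif_pos h⟩

theorem mk_of_mem {X : Type u} (B : X → StarShape W) (x : X) {p : W}
    (h : p ∈ interior (B x).carrier) : mk B x p = some ⟨x, p, h⟩ := dif_pos h

theorem mk_of_notMem {X : Type u} (B : X → StarShape W) (x : X) {p : W}
    (h : p ∉ interior (B x).carrier) : mk B x p = base B := dif_neg h

theorem continuous_mk {X : Type u} (B : X → StarShape W) (x : X) {S : Type*} [TopologicalSpace S]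
    (f : S → W) (hf : Continuous f) (hmem : ∀ s, f s ∈ (B x).carrier) :
    Continuous fun s => mk B x (f s) :=
  (isQuotientMap_collapse B).continuous.comp
    (continuous_inr.comp (continuous_sigmaMk.comp (hf.subtype_mk hmem)))

/-- Joint continuity on a product with a wedge of spheres may be checked star by star. -/
theorem continuous_prod {X : Type u} {B : X → StarShape W} {T Z : Type*} [TopologicalSpace T]
    [LocallyCompactSpace T] [TopologicalSpace Z] {F : T × StarWedge B → Z}
    (h₀ : Continuous fun t => F (t, base B))
    (h₁ : ∀ x, Continuous fun z : T × (B x).carrier => F (z.1, mk B x z.2)) : Continuous F := by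
  -- Local compactness of `T` makes the product of `T` with the collapse a quotient map; the rest
  -- distributes this product over the disjoint union.
  refine (isQuotientMap_collapse B).continuous_lift_prod_right ?_
  rw [← (Homeomorph.prodSumDistrib (X := T) (Y := Unit)
    (Z := Σ x : X, (B x).carrier)).symm.comp_continuous_iff']
  refine continuous_sum_dom.mpr ⟨h₀.comp continuous_fst, ?_⟩
  rw [← (Homeomorph.prodComm (Σ x : X, (B x).carrier) T).comp_continuous_iff',
    ← (Homeomorph.sigmaProdDistrib (X := fun x : X => (B x).carrier) (Y := T)).symm.comp_continuous_iff']
  exact continuous_sigma fun x => (h₁ x).comp continuous_swap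

end StarWedge

section

variable {X Y : Type u} (A : Correspondence.{u, w} X Y) {B : X → StarShape W} (B' : Y → StarShape W)
  (e : Stars B A.s)

theorem starMap_mk_of_mem (a : A.carrier) {p : W} (h : p ∈ interior (e.1 a).carrier) :
    starMap A B B' e.1 (StarWedge.mk B (A.s a) p) =
      StarWedge.mk B' (A.t a) ((e.1 a).radial (B' (A.t a)) p) := by
  rw [StarWedge.mk_of_mem B (A.s a) (interior_mono (e.2.1 a) h)]
  have hex : ∃ a', A.s a' = A.s a ∧ p ∈ interior (e.1 a').carrier := ⟨a, rfl, h⟩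
  -- Disjointness of the stars over one source leaves no choice of label.
  have ha : hex.choose = a := by
    by_contra hne
    exact Set.disjoint_left.mp (e.2.2 _ _ hne hex.choose_spec.1)
      (interior_subset hex.choose_spec.2) (interior_subset h)
  refine (dif_pos hex).trans ?_
  rw [ha]

theorem starMap_mk_of_forall_notMem {x : X} {p : W}
    (h : ∀ a, A.s a = x → p ∉ interior (e.1 a).carrier) :
    starMap A B B' e.1 (StarWedge.mk B x p) = StarWedge.base B' := by
  by_cases hp : p ∈ interior (B x).carrier
  · rw [StarWedge.mk_of_mem B x hp]
    exact dif_neg fun ⟨a, ha⟩ => h a ha.1 ha.2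
  · rw [StarWedge.mk_of_notMem B x hp]
    rfl

end

end StarMaps

/-! ### Products of balls as stars -/

section BoxStars

variable {J : Type} [Fintype J] {V : Type v} [NormedAddCommGroup V] [InnerProductSpace ℝ V]

theorem mem_interior_boxStar (r : J → ℝ) (hr : ∀ k, 0 < r k) (c p : PiLp 2 (fun _ : J => V)) :
    p ∈ interior (boxStar r hr c).carrier ↔ ∀ k, ‖p k - c k‖ < r k := by
  constructor
  · intro h k
    -- An interior point can be pushed slightly outwards along its ray from `c`, by a factor `1 +
    -- δ`, without leaving the box. This makes every coordinate inequality strict.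
    have hcont : Filter.Tendsto (fun δ : ℝ => c + (1 + δ) • (p - c)) (nhdsWithin 0 (Set.Ioi 0))
        (nhds p) := by
      have : Continuous fun δ : ℝ => c + (1 + δ) • (p - c) := by fun_prop
      have := (this.tendsto 0).mono_left (nhdsWithin_le_nhds (s := Set.Ioi 0))
      simpa using this
    obtain ⟨δ, h1, h2⟩ := ((hcont.eventually (mem_interior_iff_mem_nhds.mp h)).and
      self_mem_nhdsWithin).exists
    have h3 := (mem_boxStar r hr c _).mp h1 k
    have h4 : (c + (1 + δ) • (p - c)) k - c k = (1 + δ) • (p k - c k) := by simp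
    have h2' : 0 < δ := h2
    rw [h4, norm_smul, Real.norm_of_nonneg (by linarith)] at h3
    rcases (norm_nonneg (p k - c k)).eq_or_lt with h5 | h5
    · rw [← h5]; exact hr k
    · nlinarith
  · intro h
    refine mem_interior.mpr ⟨{q | ∀ k, ‖q k - c k‖ < r k}, fun q hq =>
      (mem_boxStar r hr c q).mpr fun k => (hq k).le, ?_, h⟩
    simp only [Set.ofPred_forall]
    refine isOpen_iInter_of_finite fun k => isOpen_lt ?_ continuous_const
    exact ((PiLp.continuous_apply 2 _ k).sub continuous_const).norm

/-- Equal radial functions give scaling factor `1`, so the identification is a translation. All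
later computations with star maps rest on this. -/
theorem radial_boxStar (r : J → ℝ) (hr : ∀ k, 0 < r k) (c c' p : PiLp 2 (fun _ : J => V)) :
    (boxStar r hr c).radial (boxStar r hr c') p = c' + (p - c) := by
  unfold StarShape.radial
  split_ifs with h
  · change p - c = 0 at h
    rw [h, add_zero]
    rfl
  · set θ : Metric.sphere (0 : PiLp 2 (fun _ : J => V)) 1 :=
      ⟨‖p - (boxStar r hr c).center‖⁻¹ • (p - (boxStar r hr c).center), _⟩
    have h1 : (boxStar r hr c').radius θ / (boxStar r hr c).radius θ = 1 :=
      div_self ((boxStar r hr c).radius_pos θ).ne'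
    change c' + ((boxStar r hr c').radius θ / (boxStar r hr c).radius θ) • (p - c) = _
    rw [h1, one_smul]

theorem mem_boxStar_sub (r : J → ℝ) (hr : ∀ k, 0 < r k) (c p : PiLp 2 (fun _ : J => V)) :
    p - c ∈ (boxStar r hr 0).carrier ↔ p ∈ (boxStar r hr c).carrier := by
  simp [mem_boxStar]

theorem mem_interior_boxStar_sub (r : J → ℝ) (hr : ∀ k, 0 < r k)
    (c p : PiLp 2 (fun _ : J => V)) :
    p - c ∈ interior (boxStar r hr 0).carrier ↔ p ∈ interior (boxStar r hr c).carrier := by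
  simp [mem_interior_boxStar]

/-- The radius in direction `θ` depends only on the norms of the components of `θ`, which a diagonal
isometry preserves. -/
theorem boxStar_isInvariant {G : Type*} [Group G] (ρ : G →* (V ≃ₗᵢ[ℝ] V)) (r : J → ℝ)
    (hr : ∀ k, 0 < r k)
    (ρ' : G →* (PiLp 2 (fun _ : J => V) ≃ₗᵢ[ℝ] PiLp 2 (fun _ : J => V)))
    (h : ∀ g z k, ρ' g z k = ρ g (z k)) : (boxStar (V := V) r hr 0).IsInvariant ρ' := by
  refine ⟨rfl, fun g θ θ' hθ => congrArg Inv.inv ?_⟩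
  rw [Pi.norm_def, Pi.norm_def]
  congr 2
  funext k
  ext
  simp [hθ, h, norm_smul]

section

variable {X Y : Type u} (A : Correspondence.{u, w} X Y) {B : X → StarShape (PiLp 2 (fun _ : J => V))}
  {r : J → ℝ} {hr : ∀ k, 0 < r k}

theorem starMap_boxStar_of_mem (e : Stars B A.s) (a : A.carrier) {c p : PiLp 2 (fun _ : J => V)}
    (he : e.1 a = boxStar r hr c) (h : p ∈ interior (boxStar r hr c).carrier) :
    starMap A B (fun _ => boxStar r hr 0) e.1 (StarWedge.mk B (A.s a) p) =
      StarWedge.mk (fun _ => boxStar r hr 0) (A.t a) (p - c) := by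
  rw [starMap_mk_of_mem A _ e a (he ▸ h), he, radial_boxStar, zero_add]

/-- A star map depends continuously on translation parameters. -/
theorem continuous_starMap_boxStar [Finite A.carrier] {T : Type*} [TopologicalSpace T]
    [LocallyCompactSpace T] (E : T → Stars B A.s)
    (c : A.carrier → T → PiLp 2 (fun _ : J => V)) (hc : ∀ a, Continuous (c a))
    (hE : ∀ t a, (E t).1 a = boxStar r hr (c a t)) :
    Continuous fun z : T × StarWedge B => starMap A B (fun _ => boxStar r hr 0) (E z.1).1 z.2 := by
  refine StarWedge.continuous_prod continuous_const fun x => ?_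
  have hcoord : ∀ a k, Continuous fun z : T × (B x).carrier => ‖z.2.1 k - c a z.1 k‖ := fun a k =>
    (((PiLp.continuous_apply 2 _ k).comp (continuous_subtype_val.comp continuous_snd)).sub
      ((PiLp.continuous_apply 2 _ k).comp ((hc a).comp continuous_fst))).norm
  -- A finite closed cover: one piece for each closed box over `x`, where the map is a translation
  -- followed by the collapse, and one for the complement of all open boxes, where it is constant.
  let K : Option A.carrier → Set (T × (B x).carrier) := fun o => o.elim
    {z | ∀ a, A.s a = x → ∃ k, r k ≤ ‖z.2.1 k - c a z.1 k‖}
    (fun a => {z | A.s a = x ∧ ∀ k, ‖z.2.1 k - c a z.1 k‖ ≤ r k})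
  have hbase : ∀ z : T × (B x).carrier, (∀ a, A.s a = x → ∃ k, r k ≤ ‖z.2.1 k - c a z.1 k‖) →
      starMap A B (fun _ => boxStar r hr 0) (E z.1).1 (StarWedge.mk B x z.2.1) =
        StarWedge.base _ := by
    intro z hz
    refine starMap_mk_of_forall_notMem A _ _ fun a ha hmem => ?_
    rw [hE, mem_interior_boxStar] at hmem
    obtain ⟨k, hk⟩ := hz a ha
    exact (hmem k).not_ge hk
  refine (locallyFinite_of_finite K).continuous ?_ ?_ ?_
  · refine Set.eq_univ_of_forall fun z => ?_
    by_cases hz : ∃ a, A.s a = x ∧ ∀ k, ‖z.2.1 k - c a z.1 k‖ ≤ r k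
    · obtain ⟨a, ha⟩ := hz
      exact Set.mem_iUnion.mpr ⟨some a, ha⟩
    · push Not at hz
      exact Set.mem_iUnion.mpr ⟨none, fun a ha => (hz a ha).imp fun k hk => hk.le⟩
  · rintro (_ | a)
    · change IsClosed {z : T × (B x).carrier |
        ∀ a, A.s a = x → ∃ k, r k ≤ ‖z.2.1 k - c a z.1 k‖}
      simp only [Set.ofPred_forall, Set.ofPred_exists]
      exact isClosed_iInter fun a => isClosed_iInter fun _ => isClosed_iUnion_of_finite fun k =>
        isClosed_le continuous_const (hcoord a k)
    · change IsClosed {z : T × (B x).carrier | A.s a = x ∧ ∀ k, ‖z.2.1 k - c a z.1 k‖ ≤ r k}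
      simp only [Set.ofPred_and, Set.ofPred_forall]
      exact isClosed_const.inter (isClosed_iInter fun k => isClosed_le (hcoord a k) continuous_const)
  · rintro (_ | a)
    · exact (continuousOn_const (c := StarWedge.base _)).congr fun z hz => hbase z hz
    · rw [continuousOn_iff_continuous_domRestrict]
      have hcont : Continuous fun z : K (some a) => StarWedge.mk
          (fun _ : Y => boxStar r hr (0 : PiLp 2 (fun _ : J => V))) (A.t a)
          (z.1.2.1 - c a z.1.1) := by
        refine StarWedge.continuous_mk _ _ _ ?_ fun z => ?_
        · exact (continuous_subtype_val.comp (continuous_snd.comp continuous_subtype_val)).sub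
            ((hc a).comp (continuous_fst.comp continuous_subtype_val))
        · rw [mem_boxStar_sub, mem_boxStar]
          exact z.2.2
      refine hcont.congr fun z => ?_
      have hs : A.s a = x := z.2.1
      by_cases hz : z.1.2.1 ∈ interior (boxStar r hr (c a z.1.1)).carrier
      · have := starMap_boxStar_of_mem A (E z.1.1) a (hE _ a) hz
        rw [hs] at this
        exact this.symm
      -- On the boundary of the box labelled `a` the translation formula gives the base point. So
      -- does the star map, because the closed boxes are disjoint and no other one contains the
      -- point.
      · rw [StarWedge.mk_of_notMem _ _ (by rwa [mem_interior_boxStar_sub])]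
        refine (hbase z.1 fun a' ha' => ?_).symm
        by_contra hcon
        push Not at hcon
        have hmem : z.1.2.1 ∈ ((E z.1.1).1 a').carrier := by
          rw [hE, mem_boxStar]; exact fun k => (hcon k).le
        by_cases haa : a' = a
        · subst haa
          exact hz ((mem_interior_boxStar _ _ _ _).mpr hcon)
        · refine Set.disjoint_left.mp ((E z.1.1).2.2 a' a haa (ha'.trans hs.symm)) hmem ?_
          rw [hE, mem_boxStar]
          exact z.2.2

end

end BoxStars

/-! ### Gradings and moduli spaces of cubical flow categories -/

namespace Cube

variable {N : ℕ} {a b : Cube N}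

theorem abs_lt_abs (h : a < b) : a.abs < b.abs := by
  refine Finset.card_lt_card (Finset.ssubset_iff_subset_ne.mpr ⟨fun i hi => ?_, fun he => ?_⟩)
  · simp only [Finset.mem_filter, Finset.mem_univ, true_and] at hi ⊢
    have := h.le i
    rw [hi] at this
    exact top_le_iff.mp this
  · refine h.ne (funext fun i => ?_)
    have := congrArg (i ∈ ·) he
    simp only [Finset.mem_filter, Finset.mem_univ, true_and, eq_iff_iff] at this
    exact Bool.eq_iff_iff.mpr this

theorem abs_le_abs (h : a ≤ b) : a.abs ≤ b.abs := by
  rcases h.eq_or_lt with rfl | h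
  · exact le_rfl
  · exact (abs_lt_abs h).le

theorem abs_cubeAction {G : Type w} [Group G] (σ : G →* Equiv.Perm (Fin N)) (g : G) (a : Cube N) :
    (cubeAction σ g a).abs = a.abs := by
  refine Finset.card_bij (fun i _ => (σ g)⁻¹ i) ?_ ?_ ?_
  · intro i hi
    exact Finset.mem_filter.mpr ⟨Finset.mem_univ _, (Finset.mem_filter.mp hi).2⟩
  · intro i _ j _ h
    exact (σ g)⁻¹.injective h
  · intro j hj
    refine ⟨σ g j, Finset.mem_filter.mpr ⟨Finset.mem_univ _, ?_⟩, by simp⟩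
    change a ((σ g)⁻¹ (σ g j)) = true
    simpa using (Finset.mem_filter.mp hj).2

end Cube

theorem VirtualRep.Rel.dim_eq {K : Type u} [Group K] {A B : VirtualRep K} (h : A.Rel B) :
    A.dim = B.dim := by
  obtain ⟨φ⟩ := h
  have h1 : Module.finrank ℝ (A.pos.V × B.neg.V) = Module.finrank ℝ (B.pos.V × A.neg.V) :=
    φ.toLinearEquiv.finrank_eq
  rw [Module.finrank_prod, Module.finrank_prod] at h1
  unfold VirtualRep.dim
  omega

namespace EquivariantCubicalFlowCategory

variable {G : Type w} [Group G] {N : ℕ} {σ : G →* Equiv.Perm (Fin N)}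
  (C : EquivariantCubicalFlowCategory.{u, v, w} σ)

/-- Dimensions are taken in the identity of virtual representations relating `C.grG x` to the
grading of the cube. -/
theorem gr_add_dim_susp (x : C.Obj) : C.gr x + C.susp.dim = (C.f x).abs := by
  have hx : isotropy C.act x ≤ cubeIsotropy σ (C.f x) := by
    intro g hg
    have hg' : C.act g x = x := hg
    change cubeAction σ g (C.f x) = C.f x
    rw [← C.f_act, hg']
  have h := (C.grG_f x hx).dim_eq
  have h1 : (C.grG x).dim = C.gr x := C.dim_grG x
  have h2 : Module.finrank ℝ ((C.grG x).pos.V × C.susp.pos.V) =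
    Module.finrank ℝ (C.grG x).pos.V + Module.finrank ℝ C.susp.pos.V := Module.finrank_prod
  have h3 : Module.finrank ℝ ((C.grG x).neg.V × C.susp.neg.V) =
    Module.finrank ℝ (C.grG x).neg.V + Module.finrank ℝ C.susp.neg.V := Module.finrank_prod
  have h4 : Module.finrank ℝ ({i // C.f x i = true} → ℝ) = (C.f x).abs := by
    rw [Module.finrank_pi, Fintype.card_subtype]
    rfl
  have h5 : Module.finrank ℝ (Fin 0 → ℝ) = 0 := by simp
  change ((Module.finrank ℝ ((C.grG x).pos.V × C.susp.pos.V) : ℕ) : ℤ) -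
    (Module.finrank ℝ ((C.grG x).neg.V × C.susp.neg.V) : ℕ) =
    (Module.finrank ℝ ({i // C.f x i = true} → ℝ) : ℕ) - (Module.finrank ℝ (Fin 0 → ℝ) : ℕ) at h
  rw [h2, h3, h4, h5] at h
  unfold VirtualRep.dim at h1 ⊢
  push_cast at h
  linarith

/-- The suspension shifts all gradings by the same amount. Hence multifacets of `M(x, y)`, numbered
by `C.gr`, match those of the cube, numbered by `Cube.abs`. -/
theorem gr_sub_gr (x y : C.Obj) : C.gr x - C.gr y = ((C.f x).abs : ℤ) - (C.f y).abs := by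
  have h1 := C.gr_add_dim_susp x
  have h2 := C.gr_add_dim_susp y
  linarith

variable {C}

/-- A morphism in the cube gives the weak inequality; equality would make the gradings of `x` and
`y` agree. -/
theorem f_lt {x y : C.Obj} (p : C.M x y) : C.f y < C.f x := by
  refine lt_of_le_of_ne (C.fM p).le fun h => ?_
  have h1 := C.gr_lt p
  have h2 := C.gr_sub_gr x y
  rw [h] at h2
  linarith

theorem continuous_fM (x y : C.Obj) : Continuous fun p : C.M x y => C.fM p :=
  (C.covering x y).continuous

theorem eq_of_mk_eq {x y : C.Obj} {p q : C.M x y} (h : ZerothHomotopy.mk p = ZerothHomotopy.mk q)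
    (hf : C.fM p = C.fM q) : p = q := by
  have := FreeHom.contractibleSpace (C.fM p).le
  exact (C.covering x y).eq_of_joined (Quotient.exact h) hf

theorem exists_section {x y : C.Obj} (c : ZerothHomotopy (C.M x y)) :
    ∃ s : C(FreeHom (C.f x) (C.f y), C.M x y),
      (∀ t, C.fM (s t) = t) ∧ ∀ t, ZerothHomotopy.mk (s t) = c := by
  obtain ⟨p⟩ := c
  have := FreeHom.contractibleSpace (C.fM p).le
  obtain ⟨s, hs, hj⟩ := (C.covering x y).exists_section_joined p
  exact ⟨s, hs, fun t => Quotient.sound (hj t).symm⟩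

/-- Every component meets the fibre over the empty chain. That fibre is discrete because `C.fM` is a
covering, and compact because it is closed in a compact moduli space. -/
theorem finite_zerothHomotopy (x y : C.Obj) : Finite (ZerothHomotopy (C.M x y)) := by
  by_cases h : C.f y ≤ C.f x
  · have := C.compact x y
    let F : Set (C.M x y) := (fun p => C.fM p) ⁻¹' {FreeHom.top h}
    have hF : IsCompact F := ((isClosed_singleton).preimage (continuous_fM x y)).isCompact
    have : DiscreteTopology F := (C.covering x y (FreeHom.top h)).1
    have : Finite F := by
      have := isCompact_iff_compactSpace.mp hF
      exact finite_of_compact_of_discrete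
    refine Finite.of_surjective (fun p : F => ZerothHomotopy.mk p.1) fun c => ?_
    obtain ⟨s, hs, hc⟩ := exists_section c
    exact ⟨⟨s (FreeHom.top h), hs _⟩, hc _⟩
  · have : IsEmpty (C.M x y) := ⟨fun p => h (C.fM p).le⟩
    have : IsEmpty (ZerothHomotopy (C.M x y)) := ⟨fun c => by obtain ⟨p⟩ := c; exact this.false p⟩
    infer_instance

/-! ### Path components and their points over a given morphism -/

section

variable {a b c : Cube N}

/-- The elements of the correspondence `F(a, b)`. -/
abbrev Corr (C : EquivariantCubicalFlowCategory.{u, v, w} σ) (a b : Cube N) : Type (max u v) :=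
  Σ (x : C.Fib a) (y : C.Fib b), ZerothHomotopy (C.M x.1 y.1)

/-- The path component of a point of a moduli space. -/
def toCorr {x : C.Fib a} {y : C.Fib b} (p : C.M x.1 y.1) : C.Corr a b := ⟨x, y, ZerothHomotopy.mk p⟩

/-- The point of a path component over a given morphism of the cube flow category. -/
noncomputable def point (c : C.Corr a b) (t : FreeHom a b) : C.M c.1.1 c.2.1.1 :=
  -- The objects lie over `a` and `b` only up to a propositional equality, so `t` is retyped. For
  -- this reason morphisms are compared below through their underlying functions.
  (exists_section c.2.2).choose ⟨t.1, by rw [c.1.2, c.2.1.2]; exact t.2⟩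

theorem toCorr_point (c : C.Corr a b) (t : FreeHom a b) :
    toCorr (x := c.1) (y := c.2.1) (point c t) = c := by
  have h : ZerothHomotopy.mk (point c t) = c.2.2 := (exists_section c.2.2).choose_spec.2 _
  rw [toCorr, h]

theorem mk_point (c : C.Corr a b) (t : FreeHom a b) : ZerothHomotopy.mk (point c t) = c.2.2 :=
  (exists_section c.2.2).choose_spec.2 _

theorem fM_point (c : C.Corr a b) (t : FreeHom a b) : (C.fM (point c t)).1 = t.1 := by
  have h := (exists_section c.2.2).choose_spec.1 ⟨t.1, by rw [c.1.2, c.2.1.2]; exact t.2⟩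
  exact congrArg Subtype.val h

theorem continuous_point (c : C.Corr a b) : Continuous (point c) :=
  (exists_section c.2.2).choose.continuous.comp (continuous_subtype_val.subtype_mk _)

theorem eq_point (c : C.Corr a b) (t : FreeHom a b) (p : C.M c.1.1 c.2.1.1)
    (h : ZerothHomotopy.mk p = c.2.2) (ht : (C.fM p).1 = t.1) : p = point c t :=
  eq_of_mk_eq (h.trans (mk_point c t).symm) (Subtype.ext (ht.trans (fM_point c t).symm))

theorem finite_corr [Finite C.Obj] (a b : Cube N) : Finite (C.Corr a b) := by
  have := fun (x : C.Fib a) (y : C.Fib b) => finite_zerothHomotopy (C := C) x.1 y.1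
  exact inferInstanceAs (Finite (Σ (x : C.Fib a) (y : C.Fib b), ZerothHomotopy (C.M x.1 y.1)))

theorem comp_toCorr (h₁ : c < b) (h₂ : b < a) {x : C.Fib a} {y : C.Fib b} {z : C.Fib c}
    (q : C.M y.1 z.1) (p : C.M x.1 y.1) :
    C.burnside.comp h₁ h₂ ⟨(toCorr q, toCorr p), rfl⟩ =
      toCorr (C.comp q p) := rfl

/-- Elements of composites of correspondences are represented by composable points. -/
theorem exists_rep (z : ((C.burnside.corr b c).comp (C.burnside.corr a b)).carrier)
    (s : FreeHom b c) (t : FreeHom a b) :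
    ∃ (x : C.Fib a) (y : C.Fib b) (z' : C.Fib c) (q : C.M y.1 z'.1) (p : C.M x.1 y.1),
      z = ⟨(toCorr q, toCorr p), rfl⟩ ∧ (C.fM q).1 = s.1 ∧ (C.fM p).1 = t.1 := by
  obtain ⟨⟨c₁, c₂⟩, h⟩ := z
  have h1 := toCorr_point c₁ s
  have h2 := toCorr_point c₂ t
  have f1 := fM_point c₁ s
  have f2 := fM_point c₂ t
  generalize point c₁ s = q at h1 f1
  generalize point c₂ t = p at h2 f2
  obtain ⟨y, z, c₁⟩ := c₁
  obtain ⟨x, y', c₂⟩ := c₂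
  obtain rfl : y' = y := h
  exact ⟨x, y', z, q, p, Subtype.ext (Prod.ext h1.symm h2.symm), f1, f2⟩

/-- The value of a composite in the free category depends only on the underlying functions. -/
theorem fM_comp_val (h₁ : c < b) (h₂ : b < a) {x : C.Fib a} {y : C.Fib b} {z : C.Fib c}
    {q : C.M y.1 z.1} {p : C.M x.1 y.1} {s : FreeHom b c} {t : FreeHom a b}
    (hq : (C.fM q).1 = s.1) (hp : (C.fM p).1 = t.1) :
    (C.fM (C.comp q p)).1 = (s.comp t).1 := by
  obtain ⟨x, rfl⟩ := x
  obtain ⟨y, rfl⟩ := y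
  obtain ⟨z, rfl⟩ := z
  obtain rfl : C.fM q = s := Subtype.ext hq
  obtain rfl : C.fM p = t := Subtype.ext hp
  rw [C.fM_comp]

theorem toCorr_injective {x x' : C.Fib a} {y y' : C.Fib b} {p : C.M x.1 y.1} {p' : C.M x'.1 y'.1}
    (h : toCorr p = toCorr p') (hf : (C.fM p).1 = (C.fM p').1) :
    (⟨x, y, p⟩ : Σ (x : C.Fib a) (y : C.Fib b), C.M x.1 y.1) = ⟨x', y', p'⟩ := by
  obtain rfl : x = x' := congrArg Sigma.fst h
  have h' := eq_of_heq (Sigma.mk.inj h).2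
  obtain rfl : y = y' := congrArg Sigma.fst h'
  have h'' := eq_of_heq (Sigma.mk.inj h').2
  rw [eq_of_mk_eq h'' (Subtype.ext hf)]

end

end EquivariantCubicalFlowCategory

/-! ### Factorization through an intermediate vertex and the Burnside functor -/

namespace EquivariantNeatEmbedding

open EquivariantCubicalFlowCategory

variable {G : Type w} [Group G] {N : ℕ} {σ : G →* Equiv.Perm (Fin N)}
  {C : EquivariantCubicalFlowCategory.{u, v, w} σ}
  {V : Type*} [NormedAddCommGroup V] [InnerProductSpace ℝ V] {ρ : G →* (V ≃ₗᵢ[ℝ] V)}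
  {e : Fin N → ℕ} {R : ℝ} {a b c : Cube N}

/-- A point over a composite through `b` is itself a composite through an object over `b`. -/
theorem exists_comp_eq (ι : EquivariantNeatEmbedding C ρ e R) (h₁ : c < b) (h₂ : b < a)
    {x : C.Fib a} {z : C.Fib c} (p : C.M x.1 z.1) (hp : (C.fM p).1 b = 0) :
    ∃ (y : C.Fib b) (q : C.M y.1 z.1) (p' : C.M x.1 y.1), C.comp q p' = p := by
  obtain ⟨x, rfl⟩ := x
  obtain ⟨z, rfl⟩ := z
  have hb1 := Cube.abs_lt_abs h₁
  have hb2 := Cube.abs_lt_abs h₂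
  have hgr := C.gr_sub_gr x z
  have hi1 : 1 ≤ b.abs - (C.f z).abs := by omega
  have hi2 : ((b.abs - (C.f z).abs : ℕ) : ℤ) < C.gr x - C.gr z := by omega
  -- The vanishing parameter at `b` puts `p` in the multifacet of index `|b| - |f z|`, which
  -- consists of composites.
  have hbd : p ∈ C.bd x z (b.abs - (C.f z).abs) :=
    (ι.preimage_facet _ hi1 hi2 p).mp ⟨b, h₁, h₂, by omega, hp⟩
  rw [← C.comp_range x z _ hi1 hi2] at hbd
  obtain ⟨⟨⟨y, hy⟩, q, p'⟩, rfl⟩ := hbd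
  have hfy : (C.fM (C.comp q p')).1 (C.f y) = 0 := by
    rw [C.fM_comp]
    exact FreeHom.comp_apply_mid _ _ (f_lt q) (f_lt p')
  have habs : (C.f y).abs = b.abs := by
    have := C.gr_sub_gr y z
    omega
  -- Both `C.f y` and `b` have parameter `0`, so they belong to one chain; having equally many ones,
  -- they coincide.
  have hyb : C.f y = b := by
    by_contra hne
    rcases (C.fM (C.comp q p')).2.2.2 (x := C.f y) (y := b)
      (by change (C.fM (C.comp q p')).1 (C.f y) < 1; rw [hfy]; exact zero_lt_one)
      (by change (C.fM (C.comp q p')).1 b < 1; exact hp ▸ zero_lt_one) hne with h | h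
    · exact (Cube.abs_lt_abs (lt_of_le_of_ne h hne)).ne habs
    · exact (Cube.abs_lt_abs (lt_of_le_of_ne h (Ne.symm hne))).ne habs.symm
  exact ⟨⟨y, hyb⟩, q, p', rfl⟩

/-- All objects over `b` have the same grading, so both pairs lie in the domain of the embedding
onto one multifacet. -/
theorem comp_injective (h₁ : c < b) (h₂ : b < a) {x : C.Fib a} {z : C.Fib c} {y y' : C.Fib b}
    {q : C.M y.1 z.1} {p : C.M x.1 y.1} {q' : C.M y'.1 z.1} {p' : C.M x.1 y'.1}
    (h : C.comp q p = C.comp q' p') :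
    (⟨y, q, p⟩ : Σ y : C.Fib b, C.M y.1 z.1 × C.M x.1 y.1) = ⟨y', q', p'⟩ := by
  have hb1 := Cube.abs_lt_abs h₁
  have hb2 := Cube.abs_lt_abs h₂
  have hgr := C.gr_sub_gr x.1 z.1
  have hy := C.gr_sub_gr y.1 z.1
  have hy' := C.gr_sub_gr y'.1 z.1
  rw [x.2, z.2] at hgr
  rw [y.2, z.2] at hy
  rw [y'.2, z.2] at hy'
  have hinj := (C.comp_embedding x.1 z.1 (b.abs - c.abs) (by omega) (by omega)).injective
  have h2 := hinj (a₁ := ⟨⟨y.1, by omega⟩, q, p⟩) (a₂ := ⟨⟨y'.1, by omega⟩, q', p'⟩) h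
  obtain ⟨y, hyb⟩ := y
  obtain ⟨y', hyb'⟩ := y'
  obtain rfl : y = y' := congrArg Subtype.val (congrArg Sigma.fst h2)
  obtain ⟨rfl, rfl⟩ := Prod.ext_iff.mp (eq_of_heq (Sigma.mk.inj h2).2)
  rfl

/-- For injectivity, represent both pairs over the same two morphisms: the composites then lie in
one component over one morphism, so they agree, and their factorizations agree. For surjectivity,
factor the point of the given component over a composite through `b`. -/
theorem burnside_comp_bijective (ι : EquivariantNeatEmbedding C ρ e R) (h₁ : c < b) (h₂ : b < a) :
    Function.Bijective (C.burnside.comp h₁ h₂) := by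
  constructor
  · intro z z' h
    obtain ⟨x, y, w, q, p, rfl, hq, hp⟩ := exists_rep z (FreeHom.top h₁.le) (FreeHom.top h₂.le)
    obtain ⟨x', y', w', q', p', rfl, hq', hp'⟩ :=
      exists_rep z' (FreeHom.top h₁.le) (FreeHom.top h₂.le)
    have h' := toCorr_injective (p := C.comp q p) (p' := C.comp q' p') h
      ((fM_comp_val h₁ h₂ hq hp).trans (fM_comp_val h₁ h₂ hq' hp').symm)
    obtain rfl : x = x' := congrArg Sigma.fst h'
    have h'' := eq_of_heq (Sigma.mk.inj h').2
    obtain rfl : w = w' := congrArg Sigma.fst h''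
    have h3 := comp_injective h₁ h₂ (eq_of_heq (Sigma.mk.inj h'').2)
    obtain rfl : y = y' := congrArg Sigma.fst h3
    obtain ⟨rfl, rfl⟩ := Prod.ext_iff.mp (eq_of_heq (Sigma.mk.inj h3).2)
    rfl
  · intro (k : C.Corr a c)
    let t := (FreeHom.top h₁.le).comp (FreeHom.top h₂.le)
    obtain ⟨y, q, p, h⟩ := ι.exists_comp_eq h₁ h₂ (point (C := C) k t) (by
      rw [fM_point]
      exact FreeHom.comp_apply_mid _ _ h₁ h₂)
    refine ⟨⟨(toCorr q, toCorr p), rfl⟩, ?_⟩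
    refine (comp_toCorr h₁ h₂ q p).trans ?_
    rw [h]
    exact toCorr_point k t

theorem burnside_isFunctor [Finite C.Obj] (ι : EquivariantNeatEmbedding C ρ e R) :
    C.burnside.IsFunctor where
  finite_obj v := inferInstanceAs (Finite {x : C.Obj // C.f x = v})
  finite_corr a b _ := C.finite_corr a b
  bijective := ι.burnside_comp_bijective
  source _ _ _ := rfl
  target _ _ _ := rfl
  assoc := by
    rintro u v w x h₁ h₂ h₃ ⟨z₁, y₁, ⟨r⟩⟩ ⟨z₂, y₂, ⟨q⟩⟩ ⟨z₃, y₃, ⟨p⟩⟩ e₁ e₂ e₃ e₄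
    obtain rfl : y₂ = z₁ := e₁
    obtain rfl : y₃ = z₂ := e₂
    exact congrArg (fun m => toCorr (C := C) (x := z₃) (y := y₁) m) (C.comp_assoc r q p)

end EquivariantNeatEmbedding

/-! ### The external action -/

namespace EquivariantCubicalFlowCategory

variable {G : Type w} [Group G] {N : ℕ} {σ : G →* Equiv.Perm (Fin N)}
  (C : EquivariantCubicalFlowCategory.{u, v, w} σ)

/-- The disjoint union of the correspondences `F(a, b)`. -/
abbrev TotalCorr : Type (max u v) := Σ a b : Cube N, C.Corr a b

/-- The path component of a point, in the disjoint union of all correspondences. -/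
def totalMk (m : Σ x y, C.M x y) : C.TotalCorr :=
  ⟨C.f m.1, C.f m.2.1, toCorr (x := ⟨m.1, rfl⟩) (y := ⟨m.2.1, rfl⟩) m.2.2⟩

theorem totalMk_eq {a b : Cube N} {x : C.Fib a} {y : C.Fib b} (p : C.M x.1 y.1) :
    C.totalMk ⟨x.1, y.1, p⟩ = ⟨a, b, toCorr p⟩ := by
  obtain ⟨x, rfl⟩ := x
  obtain ⟨y, rfl⟩ := y
  rfl

/-- The action of `g` on the disjoint union of the correspondences. -/
def totalMap (g : G) (c : C.TotalCorr) : C.TotalCorr :=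
  ⟨cubeAction σ g c.1, cubeAction σ g c.2.1, C.corrMap g c.1 c.2.1 c.2.2⟩

theorem totalMap_totalMk (g : G) (m : Σ x y, C.M x y) :
    C.totalMap g (C.totalMk m) = C.totalMk ⟨_, _, C.actM g m.2.2⟩ :=
  (C.totalMk_eq (x := C.fibMap g _ ⟨m.1, rfl⟩) (y := C.fibMap g _ ⟨m.2.1, rfl⟩)
    (C.actM g m.2.2)).symm

theorem totalMk_surjective : Function.Surjective C.totalMk := by
  rintro ⟨a, b, ⟨x, rfl⟩, ⟨y, rfl⟩, ⟨p⟩⟩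
  exact ⟨⟨x, y, p⟩, rfl⟩

theorem totalMap_one (c : C.TotalCorr) : C.totalMap 1 c = c := by
  obtain ⟨m, rfl⟩ := C.totalMk_surjective c
  rw [totalMap_totalMk, C.actM_one]

theorem totalMap_mul (g h : G) (c : C.TotalCorr) :
    C.totalMap (g * h) c = C.totalMap g (C.totalMap h c) := by
  obtain ⟨m, rfl⟩ := C.totalMk_surjective c
  rw [totalMap_totalMk, totalMap_totalMk, totalMap_totalMk, C.actM_mul]

/-- The inverse is induced by `g⁻¹`. The argument takes place in the total space because `g⁻¹ (g a)`
and `a` are not syntactically equal. -/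
theorem corrMap_bijective (g : G) (a b : Cube N) : Function.Bijective (C.corrMap g a b) := by
  constructor
  · intro c c' h
    have h1 : C.totalMap g ⟨a, b, c⟩ = C.totalMap g ⟨a, b, c'⟩ :=
      congrArg (fun d => (⟨_, _, d⟩ : C.TotalCorr)) h
    have h2 := congrArg (C.totalMap g⁻¹) h1
    rw [← totalMap_mul, ← totalMap_mul, inv_mul_cancel, totalMap_one, totalMap_one] at h2
    exact eq_of_heq (Sigma.mk.inj (eq_of_heq (Sigma.mk.inj h2).2)).2
  · intro d
    have h1 : C.totalMap g (C.totalMap g⁻¹ ⟨_, _, d⟩) = ⟨_, _, d⟩ := by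
      rw [← totalMap_mul, mul_inv_cancel, totalMap_one]
    generalize C.totalMap g⁻¹ ⟨_, _, d⟩ = c at h1
    obtain ⟨a', b', c⟩ := c
    obtain rfl : a' = a := (cubeAction σ g).injective (congrArg Sigma.fst h1)
    have h2 := eq_of_heq (Sigma.mk.inj h1).2
    obtain rfl : b' = b := (cubeAction σ g).injective (congrArg Sigma.fst h2)
    exact ⟨c, eq_of_heq (Sigma.mk.inj h2).2⟩

theorem sigma_fibMap_mul (g h : G) (a : Cube N) (x : C.Fib a) :
    (⟨_, C.fibMap g _ (C.fibMap h a x)⟩ : Σ a, C.Fib a) = ⟨_, C.fibMap (g * h) a x⟩ := by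
  have key : ∀ (b b' : Cube N) (y : C.Fib b) (y' : C.Fib b'), y.1 = y'.1 →
      (⟨b, y⟩ : Σ a, C.Fib a) = ⟨b', y'⟩ := by
    rintro _ _ ⟨y, rfl⟩ ⟨y', rfl⟩ h
    obtain rfl : y = y' := h
    rfl
  refine key _ _ _ _ ?_
  simp [fibMap]

theorem sigma_corrMap_mul (g h : G) (a b : Cube N) (c : C.Corr a b) :
    (⟨_, _, C.corrMap (g * h) a b c⟩ : C.TotalCorr) = ⟨_, _, C.corrMap g _ _ (C.corrMap h a b c)⟩ :=
  C.totalMap_mul g h ⟨a, b, c⟩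

theorem corrMap_comp (g : G) {a b c : Cube N} (h₁ : c < b) (h₂ : b < a)
    (z : ((C.burnside.corr b c).comp (C.burnside.corr a b)).carrier)
    (e : (C.burnside.corr _ _).t (C.corrMap g a b z.1.2) =
      (C.burnside.corr _ _).s (C.corrMap g b c z.1.1)) :
    C.corrMap g a c (C.burnside.comp h₁ h₂ z) =
      C.burnside.comp ((cubeAction σ g).lt_iff_lt.mpr h₁) ((cubeAction σ g).lt_iff_lt.mpr h₂)
        ⟨(C.corrMap g b c z.1.1, C.corrMap g a b z.1.2), e⟩ := by
  obtain ⟨⟨⟨y, z, ⟨q⟩⟩, ⟨x, y', ⟨p⟩⟩⟩, h⟩ := z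
  obtain rfl : y' = y := h
  exact congrArg (fun m => toCorr (C := C) (x := C.fibMap g a x) (y := C.fibMap g c z) m)
    (C.actM_comp g q p)

/-- The 1-morphisms are graphs, so the laws reduce to bijectivity of the induced maps, their
multiplicativity in `g`, and their compatibility with composition on representatives. -/
theorem externalAction_isExternalAction : C.externalAction.IsExternalAction where
  two_bijective g h a := by
    constructor
    · intro x y hxy
      exact congrArg (fun z => z.1.2) hxy
    · rintro ⟨⟨y, x⟩, hz⟩
      obtain rfl : C.fibMap h a x = y := hz
      exact ⟨x, rfl⟩
  two_source _ _ _ _ := rfl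
  two_target g h a x := C.sigma_fibMap_mul g h a x
  sq_bijective g a b _ := by
    constructor
    · rintro ⟨⟨x, c⟩, hx⟩ ⟨⟨x', c'⟩, hx'⟩ h
      have hc : c = c' := (C.corrMap_bijective g a b).1 (congrArg (fun z => z.1.1) h)
      subst hc
      obtain rfl : x = x' := hx.symm.trans hx'
      rfl
    · rintro ⟨⟨d, x⟩, hx⟩
      obtain ⟨c, rfl⟩ := (C.corrMap_bijective g a b).2 d
      obtain rfl : x = c.1 := (C.fibMap_bijective g a).1 hx
      exact ⟨⟨(c.2.1, c), rfl⟩, rfl⟩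
  sq_source _ _ _ _ _ := rfl
  sq_target g a b _ z := congrArg (C.fibMap g b) z.2
  group_law g h a b _ x c e₁ e₂ e₃ := ⟨C.sigma_corrMap_mul g h a b c, rfl⟩
  composition_law g a b d h₁ h₂ x c k e₁ e₂ e₃ e₄ e₅ :=
    Prod.ext (C.corrMap_comp g h₁ h₂ ⟨(c, k), e₂⟩ e₄) rfl

end EquivariantCubicalFlowCategory

namespace FramedNeatEmbedding

open EquivariantCubicalFlowCategory

variable {G : Type w} [Group G] {N : ℕ} {σ : G →* Equiv.Perm (Fin N)}
  {C : EquivariantCubicalFlowCategory.{u, v, w} σ}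
  {V : Type*} [NormedAddCommGroup V] [InnerProductSpace ℝ V] {ρ : G →* (V ≃ₗᵢ[ℝ] V)}
  {e : Fin N → ℕ} {R ε : ℝ} {a b c : Cube N}

/-! ### The star arrangement of a framed embedding -/

/-- The centre of the star labelled `c` of the arrangement over `t`. -/
noncomputable def starVec (ι : FramedNeatEmbedding C ρ e R ε) (c : C.Corr a b) (t : FreeHom a b) :
    LevelSum V e :=
  ι.vec (point c t)

/-- Since the point of a component over `t` is unique, any representative over `t` computes the
centre. -/
theorem starVec_toCorr (ι : FramedNeatEmbedding C ρ e R ε) {x : C.Fib a} {y : C.Fib b}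
    (p : C.M x.1 y.1) (t : FreeHom a b) (ht : (C.fM p).1 = t.1) :
    ι.starVec (toCorr p) t = ι.vec p :=
  congrArg ι.vec (eq_point (toCorr p) t p rfl ht).symm

theorem continuous_starVec (ι : FramedNeatEmbedding C ρ e R ε) (c : C.Corr a b) :
    Continuous (ι.starVec c) :=
  (continuous_fst.comp (ι.smooth c.1.1 c.2.1.1).continuous).comp (continuous_point c)

/-- The required point always exists and is unique, so the default centre `0` never occurs. -/
theorem arrangement_eq (ι : FramedNeatEmbedding C ρ e R ε) (hR : 0 < R) (hε : 0 < ε)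
    (t : FreeHom a b) (c : C.Corr a b) :
    ι.arrangement hR hε t c = boxStar (radii R ε b) (radii_pos hR hε b) (ι.starVec c t) := by
  have h : ∃ p : C.M c.1.1 c.2.1.1, ZerothHomotopy.mk p = c.2.2 ∧ (C.fM p).1 = t.1 :=
    ⟨point c t, mk_point c t, fM_point c t⟩
  refine congrArg (boxStar (radii R ε b) (radii_pos hR hε b)) ((dif_pos h).trans ?_)
  exact congrArg ι.vec (eq_point c t _ h.choose_spec.1 h.choose_spec.2)

theorem starVec_mem (ι : FramedNeatEmbedding C ρ e R ε) (c : C.Corr a b) (t : FreeHom a b) :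
    ι.starVec c t ∈ levelBox e R a b := by
  obtain ⟨⟨x, rfl⟩, ⟨y, rfl⟩, c⟩ := c
  exact ι.vec_mem _

theorem add_starVec_mem (ι : FramedNeatEmbedding C ρ e R ε) (c : C.Corr a b) (t : FreeHom a b)
    {z : LevelSum V e} (hz : z ∈ levelBox e ε a b) : z + ι.starVec c t ∈ levelBox e R a b := by
  obtain ⟨⟨x, rfl⟩, ⟨y, rfl⟩, c⟩ := c
  exact ι.framed_mem _ _ hz

/-- The components of a vector of levels `|b| ≤ i < |a|`. -/
noncomputable def truncate (a b : Cube N) (z : LevelSum V e) : LevelSum V e :=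
  WithLp.toLp 2 fun k => if b.abs ≤ k.1 ∧ (k.1 : ℕ) < a.abs then z k else 0

theorem truncate_apply (a b : Cube N) (z : LevelSum V e) (k : LevelIndex e) :
    truncate a b z k = if b.abs ≤ k.1 ∧ (k.1 : ℕ) < a.abs then z k else 0 := rfl

/-- From level `|b|` upwards the star has radius `ε`, so the truncated displacement is an admissible
parameter of the framing. -/
theorem truncate_sub_mem (hR : 0 < R) (hε : 0 < ε) {z q : LevelSum V e}
    (hz : q ∈ (boxStar (radii R ε b) (radii_pos hR hε b) z).carrier) :
    truncate a b (q - z) ∈ levelBox e ε a b := by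
  rw [mem_boxStar] at hz
  refine fun k => ⟨fun hk => ?_, fun hk => by rw [truncate_apply, if_neg hk]⟩
  have := hz k
  rw [radii, if_neg (not_lt.mpr hk.1)] at this
  rw [truncate_apply, if_pos hk]
  exact this

/-- On levels between `|b|` and `|a|` this is the well-definedness of the framing. On all other
levels the centre vanishes and the radii of the two boxes agree: `R` below `|b|`, `ε` from `|a|` on.
-/
theorem arrangement_subset (ι : FramedNeatEmbedding C ρ e R ε) (hR : 0 < R) (hε : 0 < ε)
    (t : FreeHom a b) (c : C.Corr a b) :
    (boxStar (radii R ε b) (radii_pos hR hε b) (ι.starVec c t)).carrier ⊆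
      (boxStar (radii R ε a) (radii_pos hR hε a) (0 : LevelSum V e)).carrier := by
  intro q hq
  have h1 := ι.add_starVec_mem c t (truncate_sub_mem (a := a) hR hε hq)
  have h2 := ι.starVec_mem c t
  rw [mem_boxStar] at hq ⊢
  intro k
  have hab := Cube.abs_le_abs t.le
  have h0 : q k - (0 : LevelSum V e) k = q k := sub_zero _
  rw [h0]
  by_cases hk : b.abs ≤ k.1 ∧ (k.1 : ℕ) < a.abs
  · have h3 := (h1 k).1 hk
    have h4 : (truncate a b (q - ι.starVec c t) + ι.starVec c t) k = q k := by
      rw [PiLp.add_apply, truncate_apply, if_pos hk, PiLp.sub_apply, sub_add_cancel]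
    rw [h4] at h3
    rwa [radii, if_pos hk.2]
  · have h3 := hq k
    rw [(h2 k).2 hk, sub_zero] at h3
    refine h3.trans_eq ?_
    unfold radii
    congr 1
    simp only [eq_iff_iff]
    omega

/-- A common point `q` would have, after truncation, two preimages over `t` under the framed
embedding, namely its displacements from the two centres paired with the corresponding points. -/
theorem arrangement_disjoint (ι : FramedNeatEmbedding C ρ e R ε) (hR : 0 < R) (hε : 0 < ε)
    (t : FreeHom a b) {c c' : C.Corr a b} (hne : c ≠ c') :
    Disjoint (boxStar (radii R ε b) (radii_pos hR hε b) (ι.starVec c t)).carrier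
      (boxStar (radii R ε b) (radii_pos hR hε b) (ι.starVec c' t)).carrier := by
  refine Set.disjoint_left.mpr fun q hq hq' => hne ?_
  have key : ∀ c : C.Corr a b,
      truncate a b (q - ι.starVec c t) + ι.starVec c t = truncate a b q := by
    intro c
    ext k
    rw [PiLp.add_apply, truncate_apply, truncate_apply]
    split_ifs with hk
    · rw [PiLp.sub_apply, sub_add_cancel]
    · rw [(ι.starVec_mem c t k).2 hk, add_zero]
  have h := (ι.framed_embedding a b).injective
    (a₁ := ⟨c.1, c.2.1, ⟨_, truncate_sub_mem (a := a) hR hε hq⟩, point c t⟩)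
    (a₂ := ⟨c'.1, c'.2.1, ⟨_, truncate_sub_mem (a := a) hR hε hq'⟩, point c' t⟩)
    (Prod.ext ((key c).trans (key c').symm) ((fM_point c t).trans (fM_point c' t).symm))
  rw [← toCorr_point c t, ← toCorr_point c' t]
  exact congrArg (fun m : (Σ (x : C.Fib a) (y : C.Fib b), (levelBox (V := V) e ε a b) × C.M x.1 y.1)
    => toCorr (x := m.1) (y := m.2.1) m.2.2.2) h

/-- The family of star arrangements of a framed embedding. -/
noncomputable def stars (ι : FramedNeatEmbedding C ρ e R ε) (hR : 0 < R) (hε : 0 < ε)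
    (t : FreeHom a b) : Stars (ι.box hR hε a) (C.burnside.corr a b).s :=
  ⟨ι.arrangement hR hε t, fun (k : C.Corr a b) => by
      have h := ι.arrangement_subset hR hε t k
      rwa [← ι.arrangement_eq] at h, fun (k : C.Corr a b) (k' : C.Corr a b) hne _ => by
      have h := ι.arrangement_disjoint hR hε t hne
      rwa [← ι.arrangement_eq, ← ι.arrangement_eq] at h⟩

theorem continuous_stars (ι : FramedNeatEmbedding C ρ e R ε) (hR : 0 < R) (hε : 0 < ε) :
    Continuous (ι.stars hR hε : FreeHom a b → _) := by
  refine Continuous.subtype_mk (continuous_pi fun (c : C.Corr a b) =>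
    continuous_induced_rng.mpr ?_) _
  -- Only the centre varies with `t`; the radial function is that of a fixed box.
  have h : ∀ t : FreeHom a b, ((ι.arrangement hR hε t c).center,
      (ι.arrangement hR hε t c).radius) = (ι.starVec c t,
        (boxStar (radii R ε b) (radii_pos hR hε b) (0 : LevelSum V e)).radius) := by
    intro t
    rw [arrangement_eq]
    rfl
  exact ((ι.continuous_starVec c).prodMk continuous_const).congr fun t => (h t).symm

theorem starMap_of_mem (ι : FramedNeatEmbedding C ρ e R ε) (hR : 0 < R) (hε : 0 < ε)
    (t : FreeHom a b) (k : C.Corr a b) {q : LevelSum V e}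
    (h : q - ι.starVec k t ∈ interior (ι.box hR hε b k.2.1).carrier) :
    starMap (C.burnside.corr a b) (ι.box hR hε a) (ι.box hR hε b) (ι.arrangement hR hε t)
        (StarWedge.mk (ι.box hR hε a) k.1 q) =
      StarWedge.mk (ι.box hR hε b) k.2.1 (q - ι.starVec k t) :=
  starMap_boxStar_of_mem (C.burnside.corr a b) (ι.stars hR hε t) k (ι.arrangement_eq hR hε t k)
    ((mem_interior_boxStar_sub _ _ _ _).mp h)

theorem starMap_of_forall_notMem (ι : FramedNeatEmbedding C ρ e R ε) (hR : 0 < R) (hε : 0 < ε)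
    (t : FreeHom a b) {x : C.Fib a} {q : LevelSum V e}
    (h : ∀ k : C.Corr a b, k.1 = x →
      q - ι.starVec k t ∉ interior (ι.box hR hε b k.2.1).carrier) :
    starMap (C.burnside.corr a b) (ι.box hR hε a) (ι.box hR hε b) (ι.arrangement hR hε t)
      (StarWedge.mk (ι.box hR hε a) x q) = StarWedge.base _ := by
  refine starMap_mk_of_forall_notMem _ _ (ι.stars hR hε t) fun (k : C.Corr a b) hk hmem => h k hk ?_
  refine (mem_interior_boxStar_sub _ _ _ _).mpr ?_
  rw [← ι.arrangement_eq hR hε]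
  exact hmem

theorem eq_of_mem_interior (ι : FramedNeatEmbedding C ρ e R ε) (hR : 0 < R) (hε : 0 < ε)
    (t : FreeHom a b) {k k' : C.Corr a b} {q : LevelSum V e}
    (h : q - ι.starVec k t ∈ interior (ι.box hR hε b k.2.1).carrier)
    (h' : q - ι.starVec k' t ∈ interior (ι.box hR hε b k'.2.1).carrier) : k = k' := by
  by_contra hne
  exact Set.disjoint_left.mp (ι.arrangement_disjoint hR hε t hne)
    ((mem_boxStar_sub _ _ _ _).mp (interior_subset h))
    ((mem_boxStar_sub _ _ _ _).mp (interior_subset h'))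

theorem mem_interior_of_sub_mem (ι : FramedNeatEmbedding C ρ e R ε) (hR : 0 < R) (hε : 0 < ε)
    (t : FreeHom a b) (k : C.Corr a b) {q : LevelSum V e}
    (h : q - ι.starVec k t ∈ interior (ι.box hR hε b k.2.1).carrier) :
    q ∈ interior (ι.box hR hε a k.1).carrier :=
  interior_mono (ι.arrangement_subset hR hε t k) ((mem_interior_boxStar_sub _ _ _ _).mp h)

/-! ### Composition and equivariance -/

/-- The composite of the points over `s` and `t` is the point of the composite label over `s.comp
t`, and vectors add under composition. -/
theorem starVec_comp (ι : FramedNeatEmbedding C ρ e R ε) (h₁ : c < b) (h₂ : b < a)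
    (z : ((C.burnside.corr b c).comp (C.burnside.corr a b)).carrier) (s : FreeHom b c)
    (t : FreeHom a b) :
    ι.starVec (C.burnside.comp h₁ h₂ z) (s.comp t) =
      ι.starVec z.1.1 s + ι.starVec z.1.2 t := by
  obtain ⟨x, y, w, q, p, rfl, hq, hp⟩ := exists_rep z s t
  refine (ι.starVec_toCorr (C.comp q p) _ (fM_comp_val h₁ h₂ hq hp)).trans ?_
  rw [ι.vec_comp]
  exact congrArg₂ _ (ι.starVec_toCorr q s hq).symm (ι.starVec_toCorr p t hp).symm

/-- On non-collapsed points both sides are translations by the same vector. The content is that the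
stars of the composite are exactly the preimages, under the first translations, of the stars over
`s`. -/
theorem starMap_comp (ι : FramedNeatEmbedding C ρ e R ε) (hR : 0 < R) (hε : 0 < ε) (h₁ : c < b)
    (h₂ : b < a) (s : FreeHom b c) (t : FreeHom a b) (p : StarWedge (ι.box hR hε a)) :
    starMap (C.burnside.corr a c) (ι.box hR hε a) (ι.box hR hε c)
        (ι.arrangement hR hε (s.comp t)) p =
      starMap (C.burnside.corr b c) (ι.box hR hε b) (ι.box hR hε c) (ι.arrangement hR hε s)
        (starMap (C.burnside.corr a b) (ι.box hR hε a) (ι.box hR hε b)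
          (ι.arrangement hR hε t) p) := by
  rcases p with _ | ⟨x, q, hq⟩
  · rfl
  rw [← StarWedge.mk_of_mem (ι.box hR hε a) x hq]
  -- Every label `m` factors as a pair `(l, k)`. If `q` is interior to the star of `m`, its
  -- translate by `k` is interior to the star of `l`, hence to the box containing that star, so `q`
  -- is interior to the star of `k`.
  have split : ∀ m : C.Corr a c,
      q - ι.starVec m (s.comp t) ∈ interior (ι.box hR hε c m.2.1).carrier →
      ∃ (l : C.Corr b c) (k : C.Corr a b), k.1 = m.1 ∧ l.1 = k.2.1 ∧
        q - ι.starVec k t ∈ interior (ι.box hR hε b k.2.1).carrier ∧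
        q - ι.starVec k t - ι.starVec l s ∈ interior (ι.box hR hε c l.2.1).carrier := by
    intro m hm
    obtain ⟨⟨⟨l, k⟩, hz⟩, rfl⟩ := (ι.burnside_comp_bijective h₁ h₂).2 m
    have hv := ι.starVec_comp h₁ h₂ ⟨(l, k), hz⟩ s t
    have hm' : q - ι.starVec k t - ι.starVec (b := c) l s ∈
        interior (ι.box hR hε c l.2.1).carrier := by
      have hq : q - ι.starVec k t - ι.starVec l s =
          q - ι.starVec (C.burnside.comp h₁ h₂ ⟨(l, k), hz⟩) (s.comp t) :=
        (sub_sub _ _ _).trans (congrArg (q - ·) ((add_comm _ _).trans hv.symm))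
      exact hq ▸ hm
    exact ⟨l, k, rfl, hz.symm, ι.mem_interior_of_sub_mem hR hε s l hm', hm'⟩
  by_cases hk : ∃ k : C.Corr a b, k.1 = x ∧
      q - ι.starVec k t ∈ interior (ι.box hR hε b k.2.1).carrier
  · obtain ⟨k, rfl, hk⟩ := hk
    rw [ι.starMap_of_mem hR hε t k hk]
    by_cases hl : ∃ l : C.Corr b c, l.1 = k.2.1 ∧
        q - ι.starVec k t - ι.starVec l s ∈ interior (ι.box hR hε c l.2.1).carrier
    · obtain ⟨l, hlk, hl⟩ := hl
      rw [← hlk, ι.starMap_of_mem hR hε s l hl]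
      have hv := ι.starVec_comp h₁ h₂ ⟨(l, k), hlk.symm⟩ s t
      have hm := ι.starMap_of_mem hR hε (s.comp t) (C.burnside.comp h₁ h₂ ⟨(l, k), hlk.symm⟩)
        (q := q) (by rw [hv, add_comm, ← sub_sub]; exact hl)
      refine hm.trans ?_
      rw [hv, add_comm, ← sub_sub]
      rfl
    · rw [ι.starMap_of_forall_notMem hR hε s fun l h1 h2 => hl ⟨l, h1, h2⟩]
      refine ι.starMap_of_forall_notMem hR hε _ fun m hm1 hm2 => ?_
      obtain ⟨l, k', _, h2, h3, h4⟩ := split m hm2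
      -- The point lies in the stars of `k` and `k'`, so disjointness identifies the labels.
      obtain rfl := ι.eq_of_mem_interior hR hε t hk h3
      exact hl ⟨l, h2, h4⟩
  · rw [ι.starMap_of_forall_notMem hR hε t fun k h1 h2 => hk ⟨k, h1, h2⟩]
    refine ι.starMap_of_forall_notMem hR hε _ fun m hm1 hm2 => ?_
    obtain ⟨l, k', h1, _, h3, _⟩ := split m hm2
    exact hk ⟨k', h1.trans hm1, h3⟩

theorem starVec_corrMap (ι : FramedNeatEmbedding C ρ e R ε) (g : G) (k : C.Corr a b)
    (t : FreeHom a b) :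
    ι.starVec (C.corrMap g a b k) (t.map (cubeAction σ g)) = diagonalRep ρ e g (ι.starVec k t) := by
  have key : ∀ (x : C.Fib a) (y : C.Fib b) (p : C.M x.1 y.1), (C.fM p).1 = t.1 →
      ι.starVec (C.corrMap g a b (toCorr p)) (t.map (cubeAction σ g)) =
        diagonalRep ρ e g (ι.starVec (toCorr p) t) := by
    intro x y p hp
    rw [ι.starVec_toCorr p t hp, ← ι.vec_act]
    refine ι.starVec_toCorr (x := C.fibMap g a x) (y := C.fibMap g b y) (C.actM g p) _ ?_
    exact (C.fM_act g p).trans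
      (congrArg (fun t : Cube N → unitInterval => fun z => t ((cubeAction σ g).symm z)) hp)
  have h := key _ _ (point k t) (fM_point k t)
  rwa [toCorr_point] at h

/-- Permuting coordinates preserves the number of ones, on which alone the radii depend. -/
theorem box_cubeAction (ι : FramedNeatEmbedding C ρ e R ε) (hR : 0 < R) (hε : 0 < ε) (g : G)
    (x : C.Fib a) (y : C.Fib (cubeAction σ g a)) :
    ι.box hR hε (cubeAction σ g a) y = ι.box hR hε a x := by
  have h : radii R ε (e := e) (cubeAction σ g a) = radii R ε a := by
    funext k
    rw [radii, radii, Cube.abs_cubeAction]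
  change boxStar _ _ _ = boxStar _ _ _
  congr 1

theorem diagonalRep_mem_interior_box (ι : FramedNeatEmbedding C ρ e R ε) (hR : 0 < R) (hε : 0 < ε)
    (g : G) (x : C.Fib a) (q : LevelSum V e) :
    diagonalRep ρ e g q ∈ interior (ι.box hR hε a x).carrier ↔
      q ∈ interior (ι.box hR hε a x).carrier := by
  refine (mem_interior_boxStar _ _ _ _).trans (Iff.trans ?_ (mem_interior_boxStar _ _ _ _).symm)
  refine forall_congr' fun k => ?_
  have h : ‖diagonalRep ρ e g q k - (0 : LevelSum V e) k‖ = ‖q k - (0 : LevelSum V e) k‖ := by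
    simp [diagonalRep]
  rw [h]

/-- The radial identification inside the action is the identity, since the two boxes coincide; only
the linear action remains. -/
theorem act_mk (ι : FramedNeatEmbedding C ρ e R ε) (hR : 0 < R) (hε : 0 < ε) (g : G) (x : C.Fib a)
    (q : LevelSum V e) :
    StarWedge.act (ι.box hR hε a) (ι.box hR hε (cubeAction σ g a)) (diagonalRep ρ e g)
        (C.fibMap g a) (StarWedge.mk (ι.box hR hε a) x q) =
      StarWedge.mk (ι.box hR hε (cubeAction σ g a)) (C.fibMap g a x) (diagonalRep ρ e g q) := by
  by_cases h : q ∈ interior (ι.box hR hε a x).carrier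
  · refine (congrArg (StarWedge.act _ _ _ _) (StarWedge.mk_of_mem _ _ h)).trans ?_
    have hr : (ι.box hR hε a x).radial
        (ι.box hR hε (cubeAction σ g a) (C.fibMap g a x)) q = q := by
      rw [ι.box_cubeAction hR hε g x]
      exact (radial_boxStar _ _ _ _ _).trans (by simp)
    exact congrArg (fun q' => StarWedge.mk (ι.box hR hε (cubeAction σ g a)) (C.fibMap g a x)
      (diagonalRep ρ e g q')) hr
  · refine (congrArg (StarWedge.act _ _ _ _) (StarWedge.mk_of_notMem _ _ h)).trans
      (StarWedge.mk_of_notMem _ _ ?_).symm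
    rwa [ι.box_cubeAction hR hε g x, diagonalRep_mem_interior_box]

/-- The star of the transported label is the image under `g` of the star of `k`, and by
`corrMap_bijective` every label over the translated vertices is transported. Hence collapsed points
correspond to collapsed points. -/
theorem act_starMap (ι : FramedNeatEmbedding C ρ e R ε) (hR : 0 < R) (hε : 0 < ε) (g : G)
    (t : FreeHom a b) (p : StarWedge (ι.box hR hε a)) :
    StarWedge.act (ι.box hR hε b) (ι.box hR hε (cubeAction σ g b)) (diagonalRep ρ e g)
        (C.fibMap g b) (starMap (C.burnside.corr a b) (ι.box hR hε a) (ι.box hR hε b)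
          (ι.arrangement hR hε t) p) =
      starMap (C.burnside.corr (cubeAction σ g a) (cubeAction σ g b))
        (ι.box hR hε (cubeAction σ g a)) (ι.box hR hε (cubeAction σ g b))
        (ι.arrangement hR hε (t.map (cubeAction σ g)))
        (StarWedge.act (ι.box hR hε a) (ι.box hR hε (cubeAction σ g a)) (diagonalRep ρ e g)
          (C.fibMap g a) p) := by
  rcases p with _ | ⟨x, q, hq⟩
  · rfl
  rw [← StarWedge.mk_of_mem (ι.box hR hε a) x hq, ι.act_mk hR hε g x q]
  have hmem : ∀ k : C.Corr a b, diagonalRep ρ e g q -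
      ι.starVec (C.corrMap g a b k) (t.map (cubeAction σ g)) ∈
        interior (ι.box hR hε (cubeAction σ g b) (C.fibMap g b k.2.1)).carrier ↔
      q - ι.starVec k t ∈ interior (ι.box hR hε b k.2.1).carrier := by
    intro k
    rw [ι.starVec_corrMap, ← map_sub, ι.box_cubeAction hR hε g k.2.1,
      ι.diagonalRep_mem_interior_box]
  by_cases hk : ∃ k : C.Corr a b, k.1 = x ∧
      q - ι.starVec k t ∈ interior (ι.box hR hε b k.2.1).carrier
  · obtain ⟨k, rfl, hk⟩ := hk
    rw [ι.starMap_of_mem hR hε t k hk, ι.act_mk hR hε g k.2.1]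
    refine Eq.trans ?_ (ι.starMap_of_mem hR hε (t.map (cubeAction σ g)) (C.corrMap g a b k)
      ((hmem k).mpr hk)).symm
    rw [ι.starVec_corrMap, map_sub]
    rfl
  · rw [ι.starMap_of_forall_notMem hR hε t fun k h1 h2 => hk ⟨k, h1, h2⟩]
    refine (ι.starMap_of_forall_notMem hR hε _ fun d hd1 hd2 => ?_).symm
    obtain ⟨k, rfl⟩ := (C.corrMap_bijective g a b).2 d
    exact hk ⟨k, (C.fibMap_bijective g a).1 hd1, (hmem k).mp hd2⟩

/-! ### The homotopy coherent diagram -/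

open Classical in
/-- The maps of the diagram: star maps, together with identities. -/
noncomputable def diagramMap (ι : FramedNeatEmbedding C ρ e R ε) (hR : 0 < R) (hε : 0 < ε)
    (t : FreeHom a b) (p : StarWedge (ι.box hR hε a)) : StarWedge (ι.box hR hε b) :=
  if h : a = b then cast (congrArg (fun a => StarWedge (ι.box hR hε a)) h) p
  else starMap (C.burnside.corr a b) (ι.box hR hε a) (ι.box hR hε b) (ι.arrangement hR hε t) p

theorem diagramMap_self (ι : FramedNeatEmbedding C ρ e R ε) (hR : 0 < R) (hε : 0 < ε)
    (t : FreeHom a a) (p : StarWedge (ι.box hR hε a)) : ι.diagramMap hR hε t p = p := by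
  simp [diagramMap]

theorem diagramMap_of_ne (ι : FramedNeatEmbedding C ρ e R ε) (hR : 0 < R) (hε : 0 < ε)
    (h : a ≠ b) (t : FreeHom a b) (p : StarWedge (ι.box hR hε a)) :
    ι.diagramMap hR hε t p =
      starMap (C.burnside.corr a b) (ι.box hR hε a) (ι.box hR hε b) (ι.arrangement hR hε t) p :=
  dif_neg h

theorem continuous_diagramMap [Finite C.Obj] (ι : FramedNeatEmbedding C ρ e R ε) (hR : 0 < R)
    (hε : 0 < ε) (a b : Cube N) :
    Continuous fun z : FreeHom a b × StarWedge (ι.box hR hε a) => ι.diagramMap hR hε z.1 z.2 := by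
  by_cases h : a = b
  · subst h
    simpa only [diagramMap_self] using continuous_snd
  · simp only [ι.diagramMap_of_ne hR hε h]
    have : Finite (C.burnside.corr a b).carrier := C.finite_corr a b
    exact continuous_starMap_boxStar (C.burnside.corr a b) (ι.stars hR hε)
      (fun k => ι.starVec k) (fun k => ι.continuous_starVec k) (fun t k => ι.arrangement_eq hR hε t k)

/-- The homotopy coherent diagram of a framed embedding. -/
noncomputable def diagram [Finite C.Obj] (ι : FramedNeatEmbedding C ρ e R ε) (hR : 0 < R)
    (hε : 0 < ε) : HCDiagram (fun a => StarWedge (ι.box hR hε a))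
      (fun a => StarWedge.base (ι.box hR hε a)) where
  map t p := ι.diagramMap hR hε t p
  continuous_map := ι.continuous_diagramMap hR hε
  map_pt := by
    intro a b t
    by_cases h : a = b
    · subst h
      exact ι.diagramMap_self hR hε t _
    · rw [ι.diagramMap_of_ne hR hε h]
      rfl
  map_id a p := ι.diagramMap_self hR hε _ p
  map_comp := by
    intro a b c s t p
    -- An endomorphism in the free category is the identity, so a composite with an equal pair of
    -- vertices is trivial; otherwise both inequalities are strict.
    by_cases h₁ : b = c
    · subst h₁
      rw [diagramMap_self, s.eq_id, FreeHom.id_comp]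
    by_cases h₂ : a = b
    · subst h₂
      rw [ι.diagramMap_self hR hε t, t.eq_id, FreeHom.comp_id]
    have h₁' := lt_of_le_of_ne s.le (Ne.symm h₁)
    have h₂' := lt_of_le_of_ne t.le (Ne.symm h₂)
    rw [ι.diagramMap_of_ne hR hε h₁, ι.diagramMap_of_ne hR hε h₂,
      ι.diagramMap_of_ne hR hε (h₁'.trans h₂').ne', ι.starMap_comp hR hε h₁' h₂']

theorem isDiagram_diagram [Finite C.Obj] (ι : FramedNeatEmbedding C ρ e R ε) (hR : 0 < R)
    (hε : 0 < ε) : ι.IsDiagram hR hε (ι.diagram hR hε) := fun _ _ h =>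
  ⟨⟨ι.stars hR hε, ι.continuous_stars hR hε⟩, fun _ => rfl, fun t p =>
    ι.diagramMap_of_ne hR hε h.ne' t p⟩

theorem toFun_psi (g : G) (a : Cube N) : (C.externalAction.psi g a).toFun = C.fibMap g a := by
  funext x
  refine congrArg (C.fibMap g a) ?_
  exact (Equiv.symm_apply_eq _).mpr rfl

theorem isCoherentRefinement_diagram [Finite C.Obj] (ι : FramedNeatEmbedding C ρ e R ε)
    (hR : 0 < R) (hε : 0 < ε) :
    IsCoherentRefinement (diagonalRep ρ e) C.burnside C.externalAction (ι.box hR hε)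
      (ι.diagram hR hε) where
  center_eq_zero _ _ := rfl
  star_family a b h := by
    obtain ⟨E, _, hE⟩ := ι.isDiagram_diagram hR hε a b h
    exact ⟨E, hE⟩
  invariant a x := boxStar_isInvariant ρ _ _ (diagonalRep ρ e) fun g z k => by simp [diagonalRep]
  coherent g a b t p := by
    rw [toFun_psi, toFun_psi]
    change StarWedge.act _ _ _ _ (ι.diagramMap hR hε t p) = ι.diagramMap hR hε _ _
    by_cases h : a = b
    · subst h
      rw [diagramMap_self, diagramMap_self]
    · rw [ι.diagramMap_of_ne hR hε h,
        ι.diagramMap_of_ne hR hε ((cubeAction σ g).injective.ne h), ι.act_starMap hR hε]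

end FramedNeatEmbedding

theorem mainTheorem5 {m N : ℕ} [NeZero m]
    (σ : Multiplicative (ZMod m) →* Equiv.Perm (Fin N))
    (C : EquivariantCubicalFlowCategory.{u, v} σ) [Finite C.Obj]
    {V : Type w} [NormedAddCommGroup V] [InnerProductSpace ℝ V] [FiniteDimensional ℝ V]
    (ρ : Multiplicative (ZMod m) →* (V ≃ₗᵢ[ℝ] V)) (e : Fin N → ℕ)
    {R ε : ℝ} (hR : 0 < R) (hε : 0 < ε) (ι : FramedNeatEmbedding C ρ e R ε) :
    C.burnside.IsFunctor ∧ C.externalAction.IsExternalAction ∧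
      ∃ D : HCDiagram (fun a => StarWedge (ι.box hR hε a))
          (fun a => StarWedge.base (ι.box hR hε a)),
        ι.IsDiagram hR hε D ∧
        IsCoherentRefinement (diagonalRep ρ e) C.burnside C.externalAction (ι.box hR hε) D := by
  exact ⟨ι.burnside_isFunctor, C.externalAction_isExternalAction, ι.diagram hR hε,
    ι.isDiagram_diagram hR hε, ι.isCoherentRefinement_diagram hR hε⟩
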